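/- Let $M^3$ be a smooth $3$-manifold, $I\subset\mathbb R$ an interval with nonempty interior (for instance $I=[0,\tau)$; derivatives at end points of $I$ are one-sided), and let $$\boldsymbol\gamma=-N^2(t,x)\,dt^2+g_{ij}(t,x)\,dx^i dx^j$$ be a smooth Lorentzian metric on $I\times M^3$ with $N>0$ and $g(t,\cdot)$ Riemannian. (Every globally hyperbolic spacetime, parametrized by the integral curves of the gradient of a time function, is of this form; nothing else about global hyperbolicity is assumed.) Put $T=N^{-1}\partial_t$, $\boldsymbol D_T f=N^{-1}\partial_t f$ for functions $f$, $h_{ij}=-\frac1{2N}\partial_t g_{ij}$, $H=g^{ij}h_{ij}$, $\mathring h_{ij}=h_{ij}-\frac H3 g_{ij}$. Let $\boldsymbol R_{\alpha\beta\gamma\delta}$, $\boldsymbol R_{\alpha\beta}$, $\boldsymbol R$ and $\boldsymbol W_{\alpha\beta\gamma\delta}$ be the Riemann, Ricci, scalar and Weyl curvatures of $\boldsymbol\gamma$, with the sign convention $\boldsymbol R_{\beta\delta}=\boldsymbol\gamma^{\alpha\gamma}\boldsymbol R_{\alpha\beta\gamma\delta}$ and Ricci curvature positive on round spheres. Put $\boldsymbol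 A_{\alpha\beta}=\boldsymbol R_{\alpha\beta}-\frac{\boldsymbol R}6\boldsymbol\gamma_{\alpha\beta}$ and $$\boldsymbol A_{\alpha\beta\gamma\delta}=\tfrac12\left(\boldsymbol A_{\alpha\gamma}\boldsymbol\gamma_{\beta\delta}-\boldsymbol A_{\alpha\delta}\boldsymbol\gamma_{\beta\gamma}+\boldsymbol A_{\beta\delta}\boldsymbol\gamma_{\alpha\gamma}-\boldsymbol A_{\beta\gamma}\boldsymbol\gamma_{\alpha\delta}\right).$$ Write $|\cdot|^2$ for the square of a tensor with respect to $\boldsymbol\gamma$, $|\cdot|_{\bar{\boldsymbol\gamma}}$ for the norm with respect to the Riemannian metric $\bar{\boldsymbol\gamma}=N^2dt^2+g$, $|\boldsymbol W|=\sqrt{|\boldsymbol W_{\alpha\beta\gamma\delta}|^2}$, $|\boldsymbol A|^2=|\boldsymbol A_{\alpha\beta\gamma\delta}|^2$, $|\boldsymbol R|_{\bar{\boldsymbol\gamma}}=|\boldsymbol R_{\alpha\beta\gamma\delta}|_{\bar{\boldsymbol\gamma}}$; repeated spatial indices are contracted with $g$. Assume that $\boldsymbol\gamma$ is a perfect fluid,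 i.e. $\boldsymbol R_{\alpha\beta}-\frac12\boldsymbol R\boldsymbol\gamma_{\alpha\beta}=\boldsymbol{\mathcal T}_{\alpha\beta}$ with $$\boldsymbol{\mathcal T}_{TT}=M,\qquad \boldsymbol{\mathcal T}_{Ti}=0,\qquad \boldsymbol{\mathcal T}_{ij}=P g_{ij},\qquad P=(k-1)M,$$ for functions $M,P,k$ on $I\times M^3$, $k$ being differentiable in $t$, and assume that $\boldsymbol\gamma$ is purely electric: $$\boldsymbol W_{Tijk}=0 .\tag{H1}$$ Let $k'=\boldsymbol D_Tk/H$ where $H\neq0$ and $k'=0$ where $H=0$. In any local coordinates $(x^1,x^2,x^3)$ on $M^3$ let $\sqrt g=\sqrt{\det(g_{ij})}$ and let $$\mathcal S=\frac{|\boldsymbol W|_{\bar{\boldsymbol\gamma}}}{|\boldsymbol R|_{\bar{\boldsymbol\gamma}}}\sqrt g\ \text{ where }\boldsymbol R_{\alpha\beta\gamma\delta}\neq0,\qquad \mathcal S=\sqrt g\ \text{ where }\boldsymbol R_{\alpha\beta\gamma\delta}=0$$ be the Weyl entropy. (i) At every point where $\boldsymbol W\neq0$, $\boldsymbol A\neq0$,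 and where moreover $\boldsymbol D_Tk=k'H$ (that is: $H\ne0$ or $\boldsymbol D_Tk=0$), $\mathcal S$ is differentiable in $t$ and $$\boldsymbol D_T\mathcal S=\frac{|\boldsymbol W||\boldsymbol A|^2}{|\boldsymbol R|_{\bar{\boldsymbol\gamma}}^3}\Big[-kH-H\frac{|\boldsymbol W|^2}{|\boldsymbol A|^2}-24\frac{\mathring h_{jl}\boldsymbol W_{TiTj}\boldsymbol W_{TiTl}}{|\boldsymbol W|^2}+4kM\frac{\mathring h_{ij}\boldsymbol W_{TiTj}}{|\boldsymbol W|^2}-H\frac{k'(3k-2)M^2}{|\boldsymbol A|^2}\Big]\sqrt g .$$ (ii) At every point where $\boldsymbol W\neq0$ (without further condition on $\boldsymbol A$, $H$ and $k$), $\mathcal S$ is differentiable in $t$ and $$\boldsymbol D_T\mathcal S=\frac{|\boldsymbol W|}{|\boldsymbol R|_{\bar{\boldsymbol\gamma}}^3}\Big[-kH|\boldsymbol A|^2-H|\boldsymbol W|^2-24|\boldsymbol A|^2\frac{\mathring h_{jl}\boldsymbol W_{TiTj}\boldsymbol W_{TiTl}}{|\boldsymbol W|^2}+4kM|\boldsymbol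 A|^2\frac{\mathring h_{ij}\boldsymbol W_{TiTj}}{|\boldsymbol W|^2}-(3k-2)M^2\,\boldsymbol D_Tk\Big]\sqrt g .$$ (iii) At every point where $\boldsymbol A=0$, $\mathcal S$ is differentiable in $t$ and $\boldsymbol D_T\mathcal S=-H\sqrt g$. -/

import Mathlib

open scoped Manifold ContDiff

noncomputable section

namespace WeylEntropy

/-- The model space of the spatial manifold. -/
abbrev E3 := EuclideanSpace ℝ (Fin 3)

/-! ### Local coordinates `(t, x¹, x², x³)` and pseudo-Riemannian geometry in coordinates

Points of coordinate space are pairs `(t, x) : ℝ × E3`.  Coordinate indices are `0` for `t` and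
`i.succ` (with `i : Fin 3`) for `xⁱ`. -/

/-- The coordinate vectors `∂ₜ, ∂₁, ∂₂, ∂₃`. -/
def coordVec : Fin 4 → ℝ × E3 :=
  Fin.cons (1, 0) (fun i => (0, EuclideanSpace.single i 1))

/-- Partial derivative of `f` in the direction of the coordinate `α`, relative to the domain `D`
(one-sided at boundary points of `D`). -/
def pd (D : Set (ℝ × E3)) (α : Fin 4) (f : ℝ × E3 → ℝ) (p : ℝ × E3) : ℝ :=
  fderivWithin ℝ f D p (coordVec α)

/-- Christoffel symbols `Γ^l_{ab}` of the metric with components `γ`. -/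
def christoffel (D : Set (ℝ × E3)) (γ : ℝ × E3 → Matrix (Fin 4) (Fin 4) ℝ)
    (l a b : Fin 4) (p : ℝ × E3) : ℝ :=
  (1 / 2) * ∑ m, (γ p)⁻¹ l m *
    (pd D a (fun q => γ q m b) p + pd D b (fun q => γ q m a) p - pd D m (fun q => γ q a b) p)

/-- The components
`R^a_{bcd} = ∂_c Γ^a_{db} - ∂_d Γ^a_{cb} + Γ^a_{cl} Γ^l_{db} - Γ^a_{dl} Γ^l_{cb}`. -/
def riemannUp (D : Set (ℝ × E3)) (γ : ℝ × E3 → Matrix (Fin 4) (Fin 4) ℝ)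
    (a b c d : Fin 4) (p : ℝ × E3) : ℝ :=
  pd D c (christoffel D γ a d b) p - pd D d (christoffel D γ a c b) p
    + ∑ l, (christoffel D γ a c l p * christoffel D γ l d b p
      - christoffel D γ a d l p * christoffel D γ l c b p)

/-- Components of a covariant four-tensor at a point. -/
abbrev Tensor4 := Fin 4 → Fin 4 → Fin 4 → Fin 4 → ℝ

/-- The Riemann tensor `R_{abcd}` (sectional curvatures of round spheres are positive:
`R_{abab} > 0`). -/
def riemann (D : Set (ℝ × E3)) (γ : ℝ × E3 → Matrix (Fin 4) (Fin 4) ℝ) (p : ℝ × E3) : Tensor4 :=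
  fun a b c d => ∑ l, γ p a l * riemannUp D γ l b c d p

/-- The Ricci tensor `R_{bd} = R^a_{bad}`. -/
def ricci (D : Set (ℝ × E3)) (γ : ℝ × E3 → Matrix (Fin 4) (Fin 4) ℝ) (p : ℝ × E3) :
    Matrix (Fin 4) (Fin 4) ℝ :=
  Matrix.of fun b d => ∑ a, riemannUp D γ a b a d p

/-- The scalar curvature. -/
def scalarCurv (D : Set (ℝ × E3)) (γ : ℝ × E3 → Matrix (Fin 4) (Fin 4) ℝ) (p : ℝ × E3) : ℝ :=
  ∑ a, ∑ b, (γ p)⁻¹ a b * ricci D γ p a b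

/-- The Weyl tensor of a four-dimensional metric, through the decomposition of the curvature. -/
def weyl (D : Set (ℝ × E3)) (γ : ℝ × E3 → Matrix (Fin 4) (Fin 4) ℝ) (p : ℝ × E3) : Tensor4 :=
  fun a b c d => riemann D γ p a b c d
    - (1 / 2) * (ricci D γ p a c * γ p b d - ricci D γ p a d * γ p b c
        + ricci D γ p b d * γ p a c - ricci D γ p b c * γ p a d)
    + scalarCurv D γ p / 6 * (γ p a c * γ p b d - γ p a d * γ p b c)

/-- The Schouten tensor `A_{ab} = R_{ab} - (R / 6) γ_{ab}`. -/
def schouten (D : Set (ℝ × E3)) (γ : ℝ × E3 → Matrix (Fin 4) (Fin 4) ℝ) (p : ℝ × E3) :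
    Matrix (Fin 4) (Fin 4) ℝ :=
  ricci D γ p - (scalarCurv D γ p / 6) • γ p

/-- The four-tensor `A_{abcd}` built from the Schouten tensor. -/
def schouten4 (D : Set (ℝ × E3)) (γ : ℝ × E3 → Matrix (Fin 4) (Fin 4) ℝ) (p : ℝ × E3) :
    Tensor4 :=
  fun a b c d => (1 / 2) * (schouten D γ p a c * γ p b d - schouten D γ p a d * γ p b c
    + schouten D γ p b d * γ p a c - schouten D γ p b c * γ p a d)

/-- The square `|Q|²` of a four-tensor with respect to the (possibly indefinite) scalar product
with matrix `m`. -/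
def normSq (m : Matrix (Fin 4) (Fin 4) ℝ) (Q : Tensor4) : ℝ :=
  ∑ a, ∑ b, ∑ c, ∑ d, ∑ a', ∑ b', ∑ c', ∑ d',
    m⁻¹ a a' * m⁻¹ b b' * m⁻¹ c c' * m⁻¹ d d' * Q a b c d * Q a' b' c' d'

/-- The block-diagonal `4 × 4` matrix `u dt² + s_{ij} dxⁱ dxʲ`. -/
def splitMatrix (u : ℝ) (s : Matrix (Fin 3) (Fin 3) ℝ) : Matrix (Fin 4) (Fin 4) ℝ :=
  Matrix.of (Fin.cons (Fin.cons u 0) (fun i => Fin.cons 0 (s i)))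

/-! ### The spacetime `I × M` with the metric `-N² dt² + g` -/

section

variable {M : Type*} [TopologicalSpace M] [ChartedSpace E3 M]

/-- The coordinate vector field `∂ᵢ` of the chart `φ`, at the point with coordinates `y`. -/
def coordFrame (φ : OpenPartialHomeomorph M E3) (y : E3) (i : Fin 3) :
    TangentSpace (𝓡 3) (φ.symm y) :=
  mfderiv (𝓡 3) (𝓡 3) φ.symm y (EuclideanSpace.single i (1 : ℝ) : E3)

/-- A function on `ℝ × M` in the coordinates given by the chart `φ`. -/
def inCoord (φ : OpenPartialHomeomorph M E3) (f : ℝ → M → ℝ) (p : ℝ × E3) : ℝ :=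
  f p.1 (φ.symm p.2)

end

/-- The data of a smooth Lorentzian metric `-N² dt² + g` on `I × M`: an interval `I` (which may
contain its end points), a positive lapse function `N` on `I × M` and a family `g` of Riemannian
metrics on `M` indexed by `t ∈ I`, both smooth in `(t, x)`.  Smoothness is expressed in charts. -/
structure SplitSpacetime (M : Type*) [TopologicalSpace M] [ChartedSpace E3 M] where
  I : Set ℝ
  ordConnected : I.OrdConnected
  nonempty_interior : (interior I).Nonempty
  lapse : ℝ → M → ℝ
  lapse_pos : ∀ t ∈ I, ∀ x, 0 < lapse t x
  lapse_smooth : ∀ φ ∈ IsManifold.maximalAtlas (𝓡 3) ∞ M,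
    ContDiffOn ℝ ∞ (fun p : ℝ × E3 => lapse p.1 (φ.symm p.2)) (I ×ˢ φ.target)
  metric : ℝ → ∀ x : M, TangentSpace (𝓡 3) x →L[ℝ] TangentSpace (𝓡 3) x →L[ℝ] ℝ
  metric_symm : ∀ t ∈ I, ∀ x, ∀ v w : TangentSpace (𝓡 3) x, metric t x v w = metric t x w v
  metric_pos : ∀ t ∈ I, ∀ x, ∀ v : TangentSpace (𝓡 3) x, v ≠ 0 → 0 < metric t x v v
  metric_smooth : ∀ φ ∈ IsManifold.maximalAtlas (𝓡 3) ∞ M, ∀ i j : Fin 3,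
    ContDiffOn ℝ ∞ (fun p : ℝ × E3 => metric p.1 (φ.symm p.2)
      (coordFrame φ p.2 i) (coordFrame φ p.2 j)) (I ×ˢ φ.target)

namespace SplitSpacetime

variable {M : Type*} [TopologicalSpace M] [ChartedSpace E3 M] (X : SplitSpacetime M)
  (φ : OpenPartialHomeomorph M E3)

/-- The coordinate domain of `I × M` belonging to the chart `φ` of `M`. -/
def dom : Set (ℝ × E3) := X.I ×ˢ φ.target

/-- The lapse function in coordinates. -/
def N (p : ℝ × E3) : ℝ := X.lapse p.1 (φ.symm p.2)

/-- The components `g_{ij}` of the space metric in coordinates. -/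
def g (p : ℝ × E3) : Matrix (Fin 3) (Fin 3) ℝ :=
  Matrix.of fun i j => X.metric p.1 (φ.symm p.2) (coordFrame φ p.2 i) (coordFrame φ p.2 j)

/-- The Lorentzian metric `γ = -N² dt² + g`. -/
def γ (p : ℝ × E3) : Matrix (Fin 4) (Fin 4) ℝ := splitMatrix (-(X.N φ p) ^ 2) (X.g φ p)

/-- The associated Riemannian metric `N² dt² + g`. -/
def γbar (p : ℝ × E3) : Matrix (Fin 4) (Fin 4) ℝ := splitMatrix ((X.N φ p) ^ 2) (X.g φ p)

/-- The curvature tensor of the spacetime. -/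
def R (p : ℝ × E3) : Tensor4 := riemann (X.dom φ) (X.γ φ) p

/-- The Weyl tensor of the spacetime. -/
def W (p : ℝ × E3) : Tensor4 := weyl (X.dom φ) (X.γ φ) p

/-- The four-tensor `A` of the spacetime. -/
def A (p : ℝ × E3) : Tensor4 := schouten4 (X.dom φ) (X.γ φ) p

/-- `D_T f = N⁻¹ ∂ₜ f` for a function `f`, where `T = N⁻¹ ∂ₜ` is the unit normal
(one-sided derivative at the end points of `I`). -/
def DT (f : ℝ × E3 → ℝ) (p : ℝ × E3) : ℝ :=
  (X.N φ p)⁻¹ * derivWithin (fun s => f (s, p.2)) X.I p.1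

/-- The second fundamental form `h_{ij} = -(1 / 2N) ∂ₜ g_{ij}`. -/
def h (p : ℝ × E3) : Matrix (Fin 3) (Fin 3) ℝ :=
  Matrix.of fun i j => -(1 / 2) * X.DT φ (fun q => X.g φ q i j) p

/-- The mean curvature `H = g^{ij} h_{ij}`. -/
def H (p : ℝ × E3) : ℝ := ∑ i, ∑ j, (X.g φ p)⁻¹ i j * X.h φ p i j

/-- The traceless second fundamental form. -/
def hring (p : ℝ × E3) : Matrix (Fin 3) (Fin 3) ℝ := X.h φ p - (X.H φ p / 3) • X.g φ p

/-- The components `W_{TiTj}`. -/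
def E (p : ℝ × E3) : Matrix (Fin 3) (Fin 3) ℝ :=
  Matrix.of fun i j => ((X.N φ p)⁻¹) ^ 2 * X.W φ p 0 i.succ 0 j.succ

/-- The contraction `h̊_{jl} W_{TiTj} W_{TiTl}` (repeated indices are contracted with `g`). -/
def hringEE (p : ℝ × E3) : ℝ :=
  ∑ i, ∑ i', ∑ j, ∑ j', ∑ l, ∑ l',
    (X.g φ p)⁻¹ i i' * (X.g φ p)⁻¹ j j' * (X.g φ p)⁻¹ l l' *
      (X.hring φ p j l * X.E φ p i j' * X.E φ p i' l')

/-- The contraction `h̊_{ij} W_{TiTj}` (repeated indices are contracted with `g`). -/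
def hringE (p : ℝ × E3) : ℝ :=
  ∑ i, ∑ i', ∑ j, ∑ j',
    (X.g φ p)⁻¹ i i' * (X.g φ p)⁻¹ j j' * (X.hring φ p i j * X.E φ p i' j')

/-- The norm `|W|` with respect to the spacetime metric. -/
def normW (p : ℝ × E3) : ℝ := √(normSq (X.γ φ p) (X.W φ p))

/-- The square `|A|²` with respect to the spacetime metric. -/
def normSqA (p : ℝ × E3) : ℝ := normSq (X.γ φ p) (X.A φ p)

/-- The norm of `W` with respect to the associated Riemannian metric. -/
def normWbar (p : ℝ × E3) : ℝ := √(normSq (X.γbar φ p) (X.W φ p))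

/-- The norm of the curvature tensor with respect to the associated Riemannian metric. -/
def normRbar (p : ℝ × E3) : ℝ := √(normSq (X.γbar φ p) (X.R φ p))

/-- The density `√g` in the coordinates given by `φ`. -/
def sqrtDet (p : ℝ × E3) : ℝ := √((X.g φ p).det)

open scoped Classical in
/-- The Weyl entropy. -/
def entropy (p : ℝ × E3) : ℝ :=
  (if X.R φ p = 0 then 1 else X.normWbar φ p / X.normRbar φ p) * X.sqrtDet φ p

/-- The function `k'`: `D_T k = k' H` where `H ≠ 0`, and `k' = 0` where `H = 0`. -/
def kPrime (k : ℝ → M → ℝ) (p : ℝ × E3) : ℝ :=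
  if X.H φ p = 0 then 0 else X.DT φ (inCoord φ k) p / X.H φ p

/-- The Einstein equation for the perfect fluid stress-energy tensor with
`𝒯_{TT} = mass`, `𝒯_{Ti} = 0`, `𝒯_{ij} = press · g_{ij}` (so `𝒯_{tt} = N² · mass`). -/
def IsPerfectFluid (mass press : ℝ → M → ℝ) : Prop :=
  ∀ φ ∈ IsManifold.maximalAtlas (𝓡 3) ∞ M, ∀ p ∈ X.dom φ,
    ricci (X.dom φ) (X.γ φ) p - (scalarCurv (X.dom φ) (X.γ φ) p / 2) • X.γ φ p
      = splitMatrix ((X.N φ p) ^ 2 * inCoord φ mass p) (inCoord φ press p • X.g φ p)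

/-- Purely electric: `W_{Tijk} = 0`. -/
def IsPurelyElectric : Prop :=
  ∀ φ ∈ IsManifold.maximalAtlas (𝓡 3) ∞ M, ∀ p ∈ X.dom φ, ∀ i j k : Fin 3,
    (X.N φ p)⁻¹ * X.W φ p 0 i.succ j.succ k.succ = 0

end SplitSpacetime

end WeylEntropy

end

noncomputable section
namespace WeylEntropy

/-! ### Partial derivatives relative to a domain -/

section PartialDerivatives

variable {D : Set (ℝ × E3)}

/-! For a purely electric perfect fluid the Weyl tensor is the Kulkarni-Nomizu product of its
electric part `E` with `γbar` (`weyl_eq_kn`): its purely spatial components form a curvature tensor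
in dimension three, hence are fixed by their contraction (`eq_zero_of_contraction_eq_zero`). Traces
of block-diagonal matrices then give |W|² = 8 tr(E²) and |A|² = 5/3 M² + 2MP + 3P², each the same
for `γ` and `γbar`, and show that W and A are orthogonal for both metrics. So |R|² with respect to
`γbar` is |W|² + |A|², and where W ≠ 0 the entropy is an explicit function of tr(E²), |A|² and √g.

The dynamics come from the second Bianchi identity for R^k_{lij} in the directions t, i, j. The
components R^k_{ljt} vanish identically, so no spatial derivative survives, and ∂ₜR^k_{lij} is
algebraic in h, E, M and P (`pd_curvMat_spatial`). Contracting k with i and raising an index yields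
an evolution equation for Q = E + (2M/3)·1 in mixed components (`pdMat_spatialRicciMix`). Its trace
is energy conservation, D_T M = (M + P)H; the trace-free part of Q gives D_T tr(E²). Since Q is
built from the metric it is smooth, and this is where the differentiability of M and E comes from.
The pressure is never differentiated: |A|² = M²(3k² - 4k + 8/3) only needs the derivative of k.
Together with D_T √g = -H√g, the quotient rule gives the formulas where W ≠ 0.

Where A = 0, also M = 0. Energy conservation reads D_T M = kHM, a linear equation along the time
line, so M, P and A vanish on the whole line (`mass_eq_zero_on_line`), the entropy is √g there, and
only the derivative of √g is left. -/

theorem pd_congr {f f' : ℝ × E3 → ℝ} (h : Set.EqOn f f' D) (α : Fin 4) {p : ℝ × E3}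
    (hp : p ∈ D) : pd D α f p = pd D α f' p := by
  unfold pd
  rw [fderivWithin_congr h (h hp)]

theorem pd_const (α : Fin 4) (c : ℝ) (p : ℝ × E3) : pd D α (fun _ => c) p = 0 := by
  simp [pd]

theorem contDiffOn_pd (hD : UniqueDiffOn ℝ D) {f : ℝ × E3 → ℝ} (hf : ContDiffOn ℝ ∞ f D)
    (α : Fin 4) : ContDiffOn ℝ ∞ (pd D α f) D :=
  (hf.fderivWithin hD (m := ∞) (by simp)).clm_apply contDiffOn_const

theorem pd_add (hD : UniqueDiffOn ℝ D) {f f' : ℝ × E3 → ℝ} (hf : ContDiffOn ℝ ∞ f D)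
    (hf' : ContDiffOn ℝ ∞ f' D) (α : Fin 4) {p : ℝ × E3} (hp : p ∈ D) :
    pd D α (fun q => f q + f' q) p = pd D α f p + pd D α f' p := by
  unfold pd
  rw [fderivWithin_fun_add (hD p hp) (hf.differentiableOn (by simp) p hp)
    (hf'.differentiableOn (by simp) p hp)]
  rfl

theorem pd_sub (hD : UniqueDiffOn ℝ D) {f f' : ℝ × E3 → ℝ} (hf : ContDiffOn ℝ ∞ f D)
    (hf' : ContDiffOn ℝ ∞ f' D) (α : Fin 4) {p : ℝ × E3} (hp : p ∈ D) :
    pd D α (fun q => f q - f' q) p = pd D α f p - pd D α f' p := by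
  unfold pd
  rw [fderivWithin_fun_sub (hD p hp) (hf.differentiableOn (by simp) p hp)
    (hf'.differentiableOn (by simp) p hp)]
  rfl

theorem pd_sum {ι : Type*} (s : Finset ι) (hD : UniqueDiffOn ℝ D) {f : ι → ℝ × E3 → ℝ}
    (hf : ∀ i, ContDiffOn ℝ ∞ (f i) D) (α : Fin 4) {p : ℝ × E3} (hp : p ∈ D) :
    pd D α (fun q => ∑ i ∈ s, f i q) p = ∑ i ∈ s, pd D α (f i) p := by
  unfold pd
  rw [fderivWithin_fun_sum (hD p hp) fun i _ => (hf i).differentiableOn (by simp) p hp]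
  simp

theorem pd_mul (hD : UniqueDiffOn ℝ D) {f f' : ℝ × E3 → ℝ} (hf : ContDiffOn ℝ ∞ f D)
    (hf' : ContDiffOn ℝ ∞ f' D) (α : Fin 4) {p : ℝ × E3} (hp : p ∈ D) :
    pd D α (fun q => f q * f' q) p = pd D α f p * f' p + f p * pd D α f' p := by
  unfold pd
  rw [fderivWithin_fun_mul (hD p hp) (hf.differentiableOn (by simp) p hp)
    (hf'.differentiableOn (by simp) p hp)]
  simp only [add_apply, smul_apply, smul_eq_mul]
  ring

/-- At end points of the time interval the domain is not a neighbourhood. Symmetry of the second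
derivative still holds there, as a limit from the interior, and this is what `hcl` provides. -/
theorem pd_comm (hD : UniqueDiffOn ℝ D) (hcl : D ⊆ closure (interior D)) {f : ℝ × E3 → ℝ}
    (hf : ContDiffOn ℝ ∞ f D) (α β : Fin 4) {p : ℝ × E3} (hp : p ∈ D) :
    pd D α (pd D β f) p = pd D β (pd D α f) p := by
  have hs : IsSymmSndFDerivWithinAt ℝ f D p :=
    (hf p hp).isSymmSndFDerivWithinAt (by
      rw [minSmoothness_of_isRCLikeNormedField]
      exact WithTop.coe_le_coe.2 le_top) hD (hcl hp) hp
  have h1 : DifferentiableWithinAt ℝ (fderivWithin ℝ f D) D p :=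
    (hf.fderivWithin hD (m := ∞) (by simp)).differentiableOn (by simp) p hp
  have key : ∀ v w : ℝ × E3, fderivWithin ℝ (fun q => fderivWithin ℝ f D q v) D p w
      = fderivWithin ℝ (fderivWithin ℝ f D) D p w v := by
    intro v w
    rw [fderivWithin_clm_apply (hD p hp) h1 (differentiableWithinAt_const _)]
    simp
  change fderivWithin ℝ (fun q => fderivWithin ℝ f D q (coordVec β)) D p (coordVec α)
    = fderivWithin ℝ (fun q => fderivWithin ℝ f D q (coordVec α)) D p (coordVec β)
  rw [key, key]
  exact hs.eq _ _

end PartialDerivatives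

/-! ### Matrix-valued functions -/

/-- The entries of `F` are smooth on `D`. -/
def SmoothMat {m n : Type*} (D : Set (ℝ × E3)) (F : ℝ × E3 → Matrix m n ℝ) : Prop :=
  ∀ i j, ContDiffOn ℝ ∞ (fun q => F q i j) D

/-- The entrywise partial derivative of a matrix-valued function. -/
def pdMat {m n : Type*} (D : Set (ℝ × E3)) (α : Fin 4) (F : ℝ × E3 → Matrix m n ℝ)
    (p : ℝ × E3) : Matrix m n ℝ :=
  Matrix.of fun i j => pd D α (fun q => F q i j) p

section MatrixFunctions

variable {l m n : Type*} [Fintype m] {D : Set (ℝ × E3)}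

theorem SmoothMat.add {F F' : ℝ × E3 → Matrix l n ℝ} (hF : SmoothMat D F) (hF' : SmoothMat D F') :
    SmoothMat D (fun q => F q + F' q) := fun i j => (hF i j).add (hF' i j)

theorem SmoothMat.sub {F F' : ℝ × E3 → Matrix l n ℝ} (hF : SmoothMat D F) (hF' : SmoothMat D F') :
    SmoothMat D (fun q => F q - F' q) := fun i j => (hF i j).sub (hF' i j)

theorem SmoothMat.mul {F : ℝ × E3 → Matrix l m ℝ} {F' : ℝ × E3 → Matrix m n ℝ}
    (hF : SmoothMat D F) (hF' : SmoothMat D F') : SmoothMat D (fun q => F q * F' q) := by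
  intro i j
  simp only [Matrix.mul_apply]
  exact ContDiffOn.sum fun k _ => (hF i k).mul (hF' k j)

theorem SmoothMat.pdMat (hD : UniqueDiffOn ℝ D) {F : ℝ × E3 → Matrix l n ℝ}
    (hF : SmoothMat D F) (α : Fin 4) : SmoothMat D (pdMat D α F) :=
  fun i j => contDiffOn_pd hD (hF i j) α

theorem smoothMat_det [DecidableEq m] {F : ℝ × E3 → Matrix m m ℝ} (hF : SmoothMat D F) :
    ContDiffOn ℝ ∞ (fun q => (F q).det) D := by
  simp only [Matrix.det_apply]
  refine ContDiffOn.sum fun σ _ => ContDiffOn.const_smul _ ?_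
  exact contDiffOn_prod fun i _ => hF _ _

/-- Cramer's rule: the entries of the inverse are quotients of determinants. -/
theorem SmoothMat.inv [DecidableEq m] {F : ℝ × E3 → Matrix m m ℝ} (hF : SmoothMat D F)
    (hdet : ∀ q ∈ D, (F q).det ≠ 0) : SmoothMat D (fun q => (F q)⁻¹) := by
  intro i j
  simp only [Matrix.inv_def, Ring.inverse_eq_inv', Matrix.smul_apply, smul_eq_mul,
    Matrix.adjugate_apply]
  refine ((smoothMat_det hF).inv hdet).mul (smoothMat_det fun a b => ?_)
  by_cases h : a = j
  · subst h
    simpa using contDiffOn_const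
  · simpa [Matrix.updateRow_ne h] using hF a b

theorem pdMat_congr {F F' : ℝ × E3 → Matrix l n ℝ} (h : ∀ q ∈ D, F q = F' q) (α : Fin 4)
    {p : ℝ × E3} (hp : p ∈ D) : pdMat D α F p = pdMat D α F' p := by
  ext i j
  exact pd_congr (fun q hq => by simp only [h q hq]) α hp

theorem pdMat_add (hD : UniqueDiffOn ℝ D) {F F' : ℝ × E3 → Matrix l n ℝ} (hF : SmoothMat D F)
    (hF' : SmoothMat D F') (α : Fin 4) {p : ℝ × E3} (hp : p ∈ D) :
    pdMat D α (fun q => F q + F' q) p = pdMat D α F p + pdMat D α F' p := by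
  ext i j
  exact pd_add hD (hF i j) (hF' i j) α hp

theorem pdMat_sub (hD : UniqueDiffOn ℝ D) {F F' : ℝ × E3 → Matrix l n ℝ} (hF : SmoothMat D F)
    (hF' : SmoothMat D F') (α : Fin 4) {p : ℝ × E3} (hp : p ∈ D) :
    pdMat D α (fun q => F q - F' q) p = pdMat D α F p - pdMat D α F' p := by
  ext i j
  exact pd_sub hD (hF i j) (hF' i j) α hp

theorem pdMat_mul (hD : UniqueDiffOn ℝ D) {F : ℝ × E3 → Matrix l m ℝ}
    {F' : ℝ × E3 → Matrix m n ℝ} (hF : SmoothMat D F) (hF' : SmoothMat D F') (α : Fin 4)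
    {p : ℝ × E3} (hp : p ∈ D) :
    pdMat D α (fun q => F q * F' q) p = pdMat D α F p * F' p + F p * pdMat D α F' p := by
  ext i j
  simp only [pdMat, Matrix.of_apply, Matrix.add_apply, Matrix.mul_apply]
  rw [pd_sum _ hD (fun k => (hF i k).mul (hF' k j)) α hp, ← Finset.sum_add_distrib]
  exact Finset.sum_congr rfl fun k _ => pd_mul hD (hF i k) (hF' k j) α hp

theorem pdMat_transpose (F : ℝ × E3 → Matrix l n ℝ) (α : Fin 4) (p : ℝ × E3) :
    pdMat D α (fun q => (F q).transpose) p = (pdMat D α F p).transpose := rfl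

theorem pdMat_comm (hD : UniqueDiffOn ℝ D) (hcl : D ⊆ closure (interior D))
    {F : ℝ × E3 → Matrix l n ℝ} (hF : SmoothMat D F) (α β : Fin 4) {p : ℝ × E3} (hp : p ∈ D) :
    pdMat D α (pdMat D β F) p = pdMat D β (pdMat D α F) p := by
  ext i j
  exact pd_comm hD hcl (hF i j) α β hp

end MatrixFunctions

/-! ### The curvature of a metric given in coordinates -/

section Curvature

variable (D : Set (ℝ × E3)) (γ : ℝ × E3 → Matrix (Fin 4) (Fin 4) ℝ)

/-- The connection matrices `(Γ_c)^a_b = Γ^a_{cb}`. -/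
def connMat (c : Fin 4) (p : ℝ × E3) : Matrix (Fin 4) (Fin 4) ℝ :=
  Matrix.of fun a b => christoffel D γ a c b p

/-- The curvature matrices `(R_{cd})^a_b = R^a_{bcd}`. -/
def curvMat (c d : Fin 4) (p : ℝ × E3) : Matrix (Fin 4) (Fin 4) ℝ :=
  Matrix.of fun a b => riemannUp D γ a b c d p

/-- A smooth nondegenerate metric on a coordinate domain. -/
structure IsSmoothMetric : Prop where
  uniqueDiffOn : UniqueDiffOn ℝ D
  subset_closure : D ⊆ closure (interior D)
  smooth : SmoothMat D γ
  symm : ∀ q ∈ D, (γ q).transpose = γ q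
  det_ne : ∀ q ∈ D, (γ q).det ≠ 0

variable {D γ}

theorem curvMat_eq (c d : Fin 4) (p : ℝ × E3) :
    curvMat D γ c d p = pdMat D c (connMat D γ d) p - pdMat D d (connMat D γ c) p
      + (connMat D γ c p * connMat D γ d p - connMat D γ d p * connMat D γ c p) := by
  ext a b
  simp [curvMat, riemannUp, pdMat, connMat, Matrix.mul_apply, Finset.sum_sub_distrib]

theorem riemann_eq_mul (p : ℝ × E3) (a b c d : Fin 4) :
    riemann D γ p a b c d = (γ p * curvMat D γ c d p) a b := by
  simp [riemann, curvMat, Matrix.mul_apply]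

theorem riemannUp_antisymm (p : ℝ × E3) (a b c d : Fin 4) :
    riemannUp D γ a b c d p = -riemannUp D γ a b d c p := by
  simp only [riemannUp, Finset.sum_sub_distrib]
  ring

theorem riemann_antisymm_right (p : ℝ × E3) (a b c d : Fin 4) :
    riemann D γ p a b c d = -riemann D γ p a b d c := by
  simp only [riemann, ← Finset.sum_neg_distrib]
  exact Finset.sum_congr rfl fun l _ => by rw [riemannUp_antisymm]; ring

namespace IsSmoothMetric

variable (hγ : IsSmoothMetric D γ)
include hγ

theorem smoothMat_connMat (c : Fin 4) : SmoothMat D (connMat D γ c) := by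
  intro a b
  refine contDiffOn_const.mul (ContDiffOn.sum fun m _ => (hγ.smooth.inv hγ.det_ne a m).mul ?_)
  exact ((contDiffOn_pd hγ.uniqueDiffOn (hγ.smooth _ _) _).add
    (contDiffOn_pd hγ.uniqueDiffOn (hγ.smooth _ _) _)).sub
    (contDiffOn_pd hγ.uniqueDiffOn (hγ.smooth _ _) _)

theorem smoothMat_curvMat (c d : Fin 4) : SmoothMat D (curvMat D γ c d) := by
  have h := hγ.smoothMat_connMat
  have := (((h d).pdMat hγ.uniqueDiffOn c).sub ((h c).pdMat hγ.uniqueDiffOn d)).add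
    (((h c).mul (h d)).sub ((h d).mul (h c)))
  intro a b
  simpa only [curvMat_eq] using this a b

/-- The second Bianchi identity, in terms of the connection and curvature matrices. -/
theorem bianchi_second (e c d : Fin 4) {p : ℝ × E3} (hp : p ∈ D) :
    (pdMat D e (curvMat D γ c d) p
        + (connMat D γ e p * curvMat D γ c d p - curvMat D γ c d p * connMat D γ e p))
      + (pdMat D c (curvMat D γ d e) p
        + (connMat D γ c p * curvMat D γ d e p - curvMat D γ d e p * connMat D γ c p))
      + (pdMat D d (curvMat D γ e c) p
        + (connMat D γ d p * curvMat D γ e c p - curvMat D γ e c p * connMat D γ d p)) = 0 := by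
  have h := hγ.smoothMat_connMat
  have hD := hγ.uniqueDiffOn
  have key : ∀ e c d : Fin 4, pdMat D e (curvMat D γ c d) p
      = pdMat D e (pdMat D c (connMat D γ d)) p - pdMat D e (pdMat D d (connMat D γ c)) p
        + ((pdMat D e (connMat D γ c) p * connMat D γ d p
            + connMat D γ c p * pdMat D e (connMat D γ d) p)
          - (pdMat D e (connMat D γ d) p * connMat D γ c p
            + connMat D γ d p * pdMat D e (connMat D γ c) p)) := by
    intro e c d
    rw [pdMat_congr (fun q _ => curvMat_eq c d q) e hp,
      pdMat_add hD (((h d).pdMat hD c).sub ((h c).pdMat hD d))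
        (((h c).mul (h d)).sub ((h d).mul (h c))) e hp,
      pdMat_sub hD ((h d).pdMat hD c) ((h c).pdMat hD d) e hp,
      pdMat_sub hD ((h c).mul (h d)) ((h d).mul (h c)) e hp,
      pdMat_mul hD (h c) (h d) e hp, pdMat_mul hD (h d) (h c) e hp]
  -- Once the second derivatives of Γ are commuted they cancel in pairs, as do the products of Γ
  -- with ∂Γ; the cubic terms are the Jacobi identity for matrix commutators.
  rw [key, key, key, curvMat_eq, curvMat_eq, curvMat_eq,
    pdMat_comm hD hγ.subset_closure (h d) e c hp, pdMat_comm hD hγ.subset_closure (h c) e d hp,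
    pdMat_comm hD hγ.subset_closure (h e) c d hp]
  noncomm_ring

theorem isUnit_det {p : ℝ × E3} (hp : p ∈ D) : IsUnit (γ p).det :=
  (hγ.det_ne p hp).isUnit

theorem pd_symm (c a b : Fin 4) {p : ℝ × E3} (hp : p ∈ D) :
    pd D c (fun q => γ q a b) p = pd D c (fun q => γ q b a) p :=
  pd_congr (fun q hq => by
    conv_lhs => rw [← hγ.symm q hq]
    rfl) c hp

theorem christoffel_symm (l a b : Fin 4) {p : ℝ × E3} (hp : p ∈ D) :
    christoffel D γ l a b p = christoffel D γ l b a p := by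
  unfold christoffel
  congr 1
  refine Finset.sum_congr rfl fun m _ => ?_
  rw [hγ.pd_symm m a b hp]
  ring

/-- Lowering the index removes the inverse metric and leaves the Christoffel symbols of the first
kind. -/
theorem mul_connMat_apply (a b c : Fin 4) {p : ℝ × E3} (hp : p ∈ D) :
    (γ p * connMat D γ c p) a b = (1 / 2) * (pd D c (fun q => γ q a b) p
      + pd D b (fun q => γ q a c) p - pd D a (fun q => γ q c b) p) := by
  have : connMat D γ c p = (γ p)⁻¹ * Matrix.of fun m b => (1 / 2) *
      (pd D c (fun q => γ q m b) p + pd D b (fun q => γ q m c) p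
        - pd D m (fun q => γ q c b) p) := by
    ext i j
    simp only [connMat, christoffel, Matrix.of_apply, Matrix.mul_apply, Finset.mul_sum]
    exact Finset.sum_congr rfl fun m _ => by ring
  rw [this, Matrix.mul_nonsing_inv_cancel_left _ _ (hγ.isUnit_det hp)]
  rfl

theorem metric_compat (c : Fin 4) {p : ℝ × E3} (hp : p ∈ D) :
    γ p * connMat D γ c p + (γ p * connMat D γ c p).transpose = pdMat D c γ p := by
  ext a b
  rw [Matrix.add_apply, Matrix.transpose_apply, hγ.mul_connMat_apply _ _ _ hp,
    hγ.mul_connMat_apply _ _ _ hp, hγ.pd_symm c b a hp, hγ.pd_symm a c b hp, hγ.pd_symm b c a hp]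
  simp only [pdMat, Matrix.of_apply]
  ring

/-- Leibniz rule with ∂γ replaced through `metric_compat`. In this form the quadratic part is
visibly skew-symmetric as a matrix, which `riemann_antisymm_left` needs. -/
theorem mul_curvMat (c d : Fin 4) {p : ℝ × E3} (hp : p ∈ D) :
    γ p * curvMat D γ c d p
      = pdMat D c (fun q => γ q * connMat D γ d q) p - pdMat D d (fun q => γ q * connMat D γ c q) p
        - (connMat D γ c p).transpose * γ p * connMat D γ d p
        + (connMat D γ d p).transpose * γ p * connMat D γ c p := by
  have hD := hγ.uniqueDiffOn
  have hs := hγ.symm p hp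
  rw [pdMat_mul hD hγ.smooth (hγ.smoothMat_connMat d) c hp,
    pdMat_mul hD hγ.smooth (hγ.smoothMat_connMat c) d hp, ← hγ.metric_compat c hp,
    ← hγ.metric_compat d hp, curvMat_eq, Matrix.transpose_mul, Matrix.transpose_mul, hs]
  noncomm_ring

theorem riemann_antisymm_left {p : ℝ × E3} (hp : p ∈ D) (a b c d : Fin 4) :
    riemann D γ p a b c d = -riemann D γ p b a c d := by
  have hD := hγ.uniqueDiffOn
  have hsm : ∀ c, SmoothMat D (fun q => γ q * connMat D γ c q) :=
    fun c => hγ.smooth.mul (hγ.smoothMat_connMat c)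
  -- The symmetric part of ∂_c(γΓ_d) is a second derivative of the metric, hence symmetric in c and
  -- d, and drops out of the curvature.
  have hd : ∀ c d, pdMat D c (fun q => γ q * connMat D γ d q) p
      + (pdMat D c (fun q => γ q * connMat D γ d q) p).transpose
      = pdMat D c (pdMat D d γ) p := by
    intro c d
    rw [← pdMat_transpose, ← pdMat_add hD (hsm d) (F' := fun q => (γ q * connMat D γ d q).transpose)
      (fun i j => hsm d j i) c hp]
    exact pdMat_congr (fun q hq => hγ.metric_compat d hq) c hp
  have h : γ p * curvMat D γ c d p + (γ p * curvMat D γ c d p).transpose = 0 := by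
    have e1 := hd c d
    have e2 := hd d c
    rw [pdMat_comm hD hγ.subset_closure hγ.smooth c d hp, ← e2] at e1
    rw [hγ.mul_curvMat c d hp]
    simp only [Matrix.transpose_add, Matrix.transpose_sub, Matrix.transpose_mul,
      Matrix.transpose_transpose, hγ.symm p hp, Matrix.mul_assoc]
    rw [← sub_eq_zero] at e1
    rw [← e1]
    abel
  have := congrFun (congrFun h a) b
  rw [riemann_eq_mul, riemann_eq_mul]
  exact eq_neg_of_add_eq_zero_left this

/-- Vanishing torsion: once the lower indices of Γ may be exchanged, every term of the cyclic sum
appears twice with opposite signs. -/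
theorem bianchi_first_up {p : ℝ × E3} (hp : p ∈ D) (a b c d : Fin 4) :
    riemannUp D γ a b c d p + riemannUp D γ a c d b p + riemannUp D γ a d b c p = 0 := by
  have h : ∀ e i j, pd D e (christoffel D γ a i j) p = pd D e (christoffel D γ a j i) p :=
    fun e i j => pd_congr (fun q hq => hγ.christoffel_symm a i j hq) e hp
  simp only [riemannUp, Finset.sum_sub_distrib]
  simp only [h c d b, h d b c, h b c d]
  simp only [fun l => hγ.christoffel_symm l d b hp, fun l => hγ.christoffel_symm l b c hp,
    fun l => hγ.christoffel_symm l c d hp]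
  ring

theorem bianchi_first {p : ℝ × E3} (hp : p ∈ D) (a b c d : Fin 4) :
    riemann D γ p a b c d + riemann D γ p a c d b + riemann D γ p a d b c = 0 := by
  simp only [riemann, ← Finset.sum_add_distrib, ← mul_add]
  exact Finset.sum_eq_zero fun l _ => by rw [hγ.bianchi_first_up hp, mul_zero]

/-- The classical octahedron argument: the four cyclic identities, one for each choice of the first
index, are combined linearly with the two antisymmetries. -/
theorem riemann_pair_symm {p : ℝ × E3} (hp : p ∈ D) (a b c d : Fin 4) :
    riemann D γ p a b c d = riemann D γ p c d a b := by
  have l := fun a b c d => hγ.riemann_antisymm_left hp a b c d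
  have r := fun a b c d => riemann_antisymm_right (D := D) (γ := γ) p a b c d
  have e := fun a b c d => hγ.bianchi_first hp a b c d
  linarith [e a b c d, e b c d a, e c d a b, e d a b c, l b c d a, l b d a c, l b a c d,
    r a c d b, l c d a b, l c a b d, l c b d a, r c a b d, r c a d b, r d b a c, r d b c a,
    l d a b c, l d b c a, l d c a b, r a b c d, r a b d c, r c d a b, r d c a b, r a d b c,
    r a d c b, r b c a d, r b d a c,
    r c b d a, r a c b d, r b a c d, r d a c b, r b c d a]

end IsSmoothMetric

end Curvature


/-! ### Block-diagonal matrices -/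

section SplitMatrix

variable (u v : ℝ) (s t : Matrix (Fin 3) (Fin 3) ℝ)

@[simp] theorem splitMatrix_zero_zero : splitMatrix u s 0 0 = u := rfl

@[simp] theorem splitMatrix_zero_succ (i : Fin 3) : splitMatrix u s 0 i.succ = 0 := rfl

@[simp] theorem splitMatrix_succ_zero (i : Fin 3) : splitMatrix u s i.succ 0 = 0 := rfl

@[simp] theorem splitMatrix_succ_succ (i j : Fin 3) : splitMatrix u s i.succ j.succ = s i j := rfl

theorem matrix_four_ext {A B : Matrix (Fin 4) (Fin 4) ℝ} (h00 : A 0 0 = B 0 0)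
    (h0 : ∀ i : Fin 3, A 0 i.succ = B 0 i.succ) (h1 : ∀ i : Fin 3, A i.succ 0 = B i.succ 0)
    (h2 : ∀ i j : Fin 3, A i.succ j.succ = B i.succ j.succ) : A = B := by
  ext a b
  induction a using Fin.cases <;> induction b using Fin.cases
  · exact h00
  · exact h0 _
  · exact h1 _
  · exact h2 _ _

theorem splitMatrix_mul :
    splitMatrix u s * splitMatrix v t = splitMatrix (u * v) (s * t) := by
  apply matrix_four_ext <;> intros <;> simp [Matrix.mul_apply, Fin.sum_univ_succ (n := 3)]

theorem splitMatrix_one : splitMatrix 1 1 = 1 := by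
  apply matrix_four_ext <;> intros <;> simp [Matrix.one_apply, Fin.succ_ne_zero, eq_comm]

theorem splitMatrix_zero : splitMatrix 0 0 = 0 := by
  apply matrix_four_ext <;> intros <;> simp

theorem splitMatrix_add :
    splitMatrix u s + splitMatrix v t = splitMatrix (u + v) (s + t) := by
  apply matrix_four_ext <;> intros <;> simp

theorem splitMatrix_smul : v • splitMatrix u s = splitMatrix (v * u) (v • s) := by
  apply matrix_four_ext <;> intros <;> simp

theorem trace_splitMatrix : (splitMatrix u s).trace = u + s.trace := by
  simp [Matrix.trace, Fin.sum_univ_succ (n := 3)]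

theorem transpose_splitMatrix : (splitMatrix u s).transpose = splitMatrix u s.transpose := by
  apply matrix_four_ext <;> intros <;> simp

theorem det_splitMatrix : (splitMatrix u s).det = u * s.det := by
  rw [Matrix.det_succ_row_zero]
  simp [Fin.sum_univ_succ (n := 3)]
  exact Or.inl rfl

variable {u s}

theorem inv_splitMatrix (hu : u ≠ 0) (hs : IsUnit s.det) :
    (splitMatrix u s)⁻¹ = splitMatrix u⁻¹ s⁻¹ := by
  apply Matrix.inv_eq_right_inv
  rw [splitMatrix_mul, mul_inv_cancel₀ hu, Matrix.mul_nonsing_inv _ hs, splitMatrix_one]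

end SplitMatrix

/-! ### Kulkarni-Nomizu products and their scalar products -/

section KulkarniNomizu

/-- The Kulkarni-Nomizu product of two symmetric two-tensors. -/
def kn (X Y : Matrix (Fin 4) (Fin 4) ℝ) : Tensor4 :=
  fun a b c d => X a c * Y b d + X b d * Y a c - X a d * Y b c - X b c * Y a d

theorem kn_zero_left (Y : Matrix (Fin 4) (Fin 4) ℝ) : kn 0 Y = 0 := by
  funext a b c d
  simp [kn]

/-- All four indices of `Q` contracted with `L`. -/
def raise (L : Matrix (Fin 4) (Fin 4) ℝ) (Q : Tensor4) : Tensor4 :=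
  fun a b c d => ∑ a', ∑ b', ∑ c', ∑ d', L a a' * L b b' * L c c' * L d d' * Q a' b' c' d'

/-- The full contraction of two four-tensors. -/
def dot4 (Q Q' : Tensor4) : ℝ := ∑ a, ∑ b, ∑ c, ∑ d, Q a b c d * Q' a b c d

/-- The scalar product of four-tensors with respect to `m`. -/
def inner4 (m : Matrix (Fin 4) (Fin 4) ℝ) (Q Q' : Tensor4) : ℝ := dot4 Q (raise m⁻¹ Q')

theorem normSq_eq_inner4 (m : Matrix (Fin 4) (Fin 4) ℝ) (Q : Tensor4) :
    normSq m Q = inner4 m Q Q := by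
  simp only [normSq, inner4, dot4, raise, Finset.mul_sum]
  refine Finset.sum_congr rfl fun a _ => Finset.sum_congr rfl fun b _ =>
    Finset.sum_congr rfl fun c _ => Finset.sum_congr rfl fun d _ =>
    Finset.sum_congr rfl fun a' _ => Finset.sum_congr rfl fun b' _ =>
    Finset.sum_congr rfl fun c' _ => Finset.sum_congr rfl fun d' _ => ?_
  ring

theorem dot4_add_left (P Q R : Tensor4) : dot4 (P + Q) R = dot4 P R + dot4 Q R := by
  simp only [dot4, Pi.add_apply, add_mul, Finset.sum_add_distrib]

theorem dot4_add_right (P Q R : Tensor4) : dot4 P (Q + R) = dot4 P Q + dot4 P R := by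
  simp only [dot4, Pi.add_apply, mul_add, Finset.sum_add_distrib]

theorem dot4_smul_left (c : ℝ) (P Q : Tensor4) : dot4 (c • P) Q = c * dot4 P Q := by
  simp only [dot4, Pi.smul_apply, smul_eq_mul, Finset.mul_sum, mul_assoc]

theorem dot4_smul_right (c : ℝ) (P Q : Tensor4) : dot4 P (c • Q) = c * dot4 P Q := by
  simp only [dot4, Pi.smul_apply, smul_eq_mul, Finset.mul_sum, mul_left_comm c]

theorem raise_add (L : Matrix (Fin 4) (Fin 4) ℝ) (P Q : Tensor4) :
    raise L (P + Q) = raise L P + raise L Q := by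
  funext a b c d
  simp only [raise, Pi.add_apply, mul_add, Finset.sum_add_distrib]

theorem raise_smul (L : Matrix (Fin 4) (Fin 4) ℝ) (r : ℝ) (P : Tensor4) :
    raise L (r • P) = r • raise L P := by
  funext a b c d
  simp only [raise, Pi.smul_apply, smul_eq_mul, Finset.mul_sum, mul_left_comm r]

theorem inner4_smul_left (m : Matrix (Fin 4) (Fin 4) ℝ) (r : ℝ) (P Q : Tensor4) :
    inner4 m (r • P) Q = r * inner4 m P Q := dot4_smul_left _ _ _

theorem inner4_smul_right (m : Matrix (Fin 4) (Fin 4) ℝ) (r : ℝ) (P Q : Tensor4) :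
    inner4 m P (r • Q) = r * inner4 m P Q := by
  rw [inner4, raise_smul, dot4_smul_right, inner4]

theorem normSq_zero (m : Matrix (Fin 4) (Fin 4) ℝ) : normSq m 0 = 0 := by
  simp [normSq]

theorem normSq_add (m : Matrix (Fin 4) (Fin 4) ℝ) (P Q : Tensor4) :
    normSq m (P + Q) = normSq m P + inner4 m P Q + inner4 m Q P + normSq m Q := by
  simp only [normSq_eq_inner4, inner4, raise_add, dot4_add_left, dot4_add_right]
  ring

theorem normSq_smul (m : Matrix (Fin 4) (Fin 4) ℝ) (r : ℝ) (Q : Tensor4) :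
    normSq m (r • Q) = r ^ 2 * normSq m Q := by
  rw [normSq_eq_inner4, inner4_smul_left, inner4_smul_right, normSq_eq_inner4]
  ring

theorem sum_mul_mul_sandwich (L X : Matrix (Fin 4) (Fin 4) ℝ) (a b : Fin 4) :
    (L * X * L.transpose) a b = ∑ i, ∑ j, L a i * L b j * X i j := by
  simp only [Matrix.mul_apply, Matrix.transpose_apply, Finset.sum_mul]
  rw [Finset.sum_comm]
  exact Finset.sum_congr rfl fun i _ => Finset.sum_congr rfl fun j _ => by ring

theorem sum_four_ac_bd (p q : Fin 4 → Fin 4 → ℝ) :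
    ∑ a, ∑ b, ∑ c, ∑ d, p a c * q b d = (∑ a, ∑ c, p a c) * ∑ b, ∑ d, q b d := by
  simp only [← Finset.mul_sum, ← Finset.sum_mul]

theorem sum_four_ad_bc (p q : Fin 4 → Fin 4 → ℝ) :
    ∑ a, ∑ b, ∑ c, ∑ d, p a d * q b c = (∑ a, ∑ d, p a d) * ∑ b, ∑ c, q b c := by
  rw [← sum_four_ac_bd]
  exact Finset.sum_congr rfl fun a _ => Finset.sum_congr rfl fun b _ => Finset.sum_comm

/-- Each summand of a Kulkarni-Nomizu product splits into two factors with disjoint indices, so the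
contractions act on each factor as X ↦ L X Lᵀ. -/
theorem raise_kn (L X Y : Matrix (Fin 4) (Fin 4) ℝ) :
    raise L (kn X Y) = kn (L * X * L.transpose) (L * Y * L.transpose) := by
  funext a b c d
  have h : ∀ a' b' c' d', L a a' * L b b' * L c c' * L d d' * kn X Y a' b' c' d'
      = (L a a' * L c c' * X a' c') * (L b b' * L d d' * Y b' d')
        + (L a a' * L c c' * Y a' c') * (L b b' * L d d' * X b' d')
        - (L a a' * L d d' * X a' d') * (L b b' * L c c' * Y b' c')
        - (L a a' * L d d' * Y a' d') * (L b b' * L c c' * X b' c') := by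
    intros
    simp only [kn]
    ring
  simp only [raise, h, Finset.sum_add_distrib, Finset.sum_sub_distrib]
  rw [sum_four_ac_bd (fun a' c' => L a a' * L c c' * X a' c')
      (fun b' d' => L b b' * L d d' * Y b' d'),
    sum_four_ac_bd (fun a' c' => L a a' * L c c' * Y a' c')
      (fun b' d' => L b b' * L d d' * X b' d'),
    sum_four_ad_bc (fun a' d' => L a a' * L d d' * X a' d')
      (fun b' c' => L b b' * L c c' * Y b' c'),
    sum_four_ad_bc (fun a' d' => L a a' * L d d' * Y a' d')
      (fun b' c' => L b b' * L c c' * X b' c')]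
  simp only [← sum_mul_mul_sandwich, kn]
  ring

theorem sum_four_cycle (X Y Z W : Matrix (Fin 4) (Fin 4) ℝ) :
    ∑ a, ∑ b, ∑ c, ∑ d, X a c * Y b c * (Z b d * W a d)
      = (X * Y.transpose * Z * W.transpose).trace := by
  simp only [Matrix.trace, Matrix.diag_apply, Matrix.mul_apply, Matrix.transpose_apply,
    Finset.sum_mul]
  refine Finset.sum_congr rfl fun a _ => ?_
  symm
  rw [Finset.sum_comm]
  refine Finset.sum_congr rfl fun b _ => ?_
  rw [Finset.sum_comm]
  exact Finset.sum_congr rfl fun c _ => Finset.sum_congr rfl fun d _ => by ring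

theorem sum_mul_eq_trace {X Y : Matrix (Fin 4) (Fin 4) ℝ} (hY : Y.transpose = Y) :
    ∑ a, ∑ c, X a c * Y a c = (X * Y).trace := by
  conv_rhs => rw [← hY]
  simp [Matrix.trace, Matrix.mul_apply]

/-- Of the sixteen products, eight pair equal index pairs and give products of two traces; the other
eight chain the indices into a cycle and give one trace of four factors. Symmetry and cyclicity make
them agree in groups of four. -/
theorem dot4_kn {X Y X' Y' : Matrix (Fin 4) (Fin 4) ℝ} (hX : X.transpose = X)
    (hY : Y.transpose = Y) (hX' : X'.transpose = X') (hY' : Y'.transpose = Y') :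
    dot4 (kn X Y) (kn X' Y') = 4 * ((X * X').trace * (Y * Y').trace
      + (X * Y').trace * (Y * X').trace - (X * Y' * Y * X').trace - (X * X' * Y * Y').trace) := by
  have h : ∀ a b c d, kn X Y a b c d * kn X' Y' a b c d
      = (X a c * X' a c) * (Y b d * Y' b d) + (X a c * Y' a c) * (Y b d * X' b d)
        + (Y a c * X' a c) * (X b d * Y' b d) + (Y a c * Y' a c) * (X b d * X' b d)
        + (X a d * X' a d) * (Y b c * Y' b c) + (X a d * Y' a d) * (Y b c * X' b c)
        + (Y a d * X' a d) * (X b c * Y' b c) + (Y a d * Y' a d) * (X b c * X' b c)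
        - X a c * Y' b c * (Y b d * X' a d) - X a c * X' b c * (Y b d * Y' a d)
        - Y a c * Y' b c * (X b d * X' a d) - Y a c * X' b c * (X b d * Y' a d)
        - X' a c * Y b c * (Y' b d * X a d) - Y' a c * Y b c * (X' b d * X a d)
        - X' a c * X b c * (Y' b d * Y a d) - Y' a c * X b c * (X' b d * Y a d) := by
    intros
    simp only [kn]
    ring
  have ac : ∀ X X' Y Y' : Matrix (Fin 4) (Fin 4) ℝ, X'.transpose = X' → Y'.transpose = Y' →
      ∑ a, ∑ b, ∑ c, ∑ d, (X a c * X' a c) * (Y b d * Y' b d)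
        = (X * X').trace * (Y * Y').trace := fun X X' Y Y' h h' => by
    rw [sum_four_ac_bd (fun a c => X a c * X' a c) (fun b d => Y b d * Y' b d),
      sum_mul_eq_trace h, sum_mul_eq_trace h']
  have ad : ∀ X X' Y Y' : Matrix (Fin 4) (Fin 4) ℝ, X'.transpose = X' → Y'.transpose = Y' →
      ∑ a, ∑ b, ∑ c, ∑ d, (X a d * X' a d) * (Y b c * Y' b c)
        = (X * X').trace * (Y * Y').trace := fun X X' Y Y' h h' => by
    rw [sum_four_ad_bc (fun a c => X a c * X' a c) (fun b d => Y b d * Y' b d),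
      sum_mul_eq_trace h, sum_mul_eq_trace h']
  simp only [dot4, h, Finset.sum_add_distrib, Finset.sum_sub_distrib, sum_four_cycle,
    ac _ _ _ _ hX' hY', ac _ _ _ _ hY' hX', ad _ _ _ _ hX' hY', ad _ _ _ _ hY' hX', hX, hY, hX',
    hY']
  have cyc : ∀ X Y Z W : Matrix (Fin 4) (Fin 4) ℝ,
      (X * Y * Z * W).trace = (Y * Z * W * X).trace := by
    intro X Y Z W
    rw [Matrix.mul_assoc, Matrix.mul_assoc, Matrix.trace_mul_comm]
    simp only [Matrix.mul_assoc]
  rw [← cyc Y X' X Y', ← cyc Y' Y X' X, ← cyc X Y' Y X', ← cyc Y Y' X X', ← cyc X' Y Y' X,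
    ← cyc X X' Y Y']
  ring

/-- Stated through the endomorphisms m⁻¹X, because for the metrics at hand these are block-diagonal
and their traces can be read off. -/
theorem inner4_kn {m X Y X' Y' : Matrix (Fin 4) (Fin 4) ℝ} (hm : m.transpose = m)
    (hX : X.transpose = X)
    (hY : Y.transpose = Y) (hX' : X'.transpose = X') (hY' : Y'.transpose = Y') :
    inner4 m (kn X Y) (kn X' Y') = 4 * (
      ((m⁻¹ * X) * (m⁻¹ * X')).trace * ((m⁻¹ * Y) * (m⁻¹ * Y')).trace
      + ((m⁻¹ * X) * (m⁻¹ * Y')).trace * ((m⁻¹ * Y) * (m⁻¹ * X')).trace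
      - ((m⁻¹ * X) * (m⁻¹ * Y') * (m⁻¹ * Y) * (m⁻¹ * X')).trace
      - ((m⁻¹ * X) * (m⁻¹ * X') * (m⁻¹ * Y) * (m⁻¹ * Y')).trace) := by
  have hL : (m⁻¹).transpose = m⁻¹ := by rw [Matrix.transpose_nonsing_inv, hm]
  have two : ∀ X X' : Matrix (Fin 4) (Fin 4) ℝ,
      (X * (m⁻¹ * X' * m⁻¹)).trace = ((m⁻¹ * X) * (m⁻¹ * X')).trace := by
    intro X X'
    rw [← Matrix.mul_assoc, Matrix.trace_mul_comm]
    simp only [Matrix.mul_assoc]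
  have four : ∀ X Y Z W : Matrix (Fin 4) (Fin 4) ℝ,
      (X * (m⁻¹ * Y * m⁻¹) * Z * (m⁻¹ * W * m⁻¹)).trace
        = ((m⁻¹ * X) * (m⁻¹ * Y) * (m⁻¹ * Z) * (m⁻¹ * W)).trace := by
    intro X Y Z W
    rw [← Matrix.mul_assoc (X * _ * Z), Matrix.trace_mul_comm]
    simp only [Matrix.mul_assoc]
  rw [inner4, raise_kn, dot4_kn hX hY]
  · rw [hL, two X X', two Y Y', two X Y', two Y X', four, four]
  · simp only [Matrix.transpose_mul, hX', hL, Matrix.mul_assoc]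
  · simp only [Matrix.transpose_mul, hY', hL, Matrix.mul_assoc]

end KulkarniNomizu

/-! ### Algebraic curvature tensors in dimension three -/

/-- In dimension three an algebraic curvature tensor is determined by its Ricci contraction. -/
theorem eq_zero_of_contraction_eq_zero {G : Matrix (Fin 3) (Fin 3) ℝ} (hG : G.transpose = G)
    (hdet : G.det ≠ 0) {C : Fin 3 → Fin 3 → Fin 3 → Fin 3 → ℝ}
    (hl : ∀ i j k l, C i j k l = -C j i k l) (hr : ∀ i j k l, C i j k l = -C i j l k)
    (hp : ∀ i j k l, C i j k l = C k l i j)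
    (htr : ∀ j l, ∑ i, ∑ k, G i k * C i j k l = 0) : C = 0 := by
  have g10 : G 1 0 = G 0 1 := congrFun (congrFun hG 0) 1
  have g20 : G 2 0 = G 0 2 := congrFun (congrFun hG 0) 2
  have g21 : G 2 1 = G 1 2 := congrFun (congrFun hG 1) 2
  have hll : ∀ i k l, C i i k l = 0 := fun i k l => by linarith [hl i i k l]
  have hrr : ∀ i k l, C k l i i = 0 := fun i k l => by linarith [hr k l i i]
  have l10 : ∀ k l, C 1 0 k l = -C 0 1 k l := fun k l => hl 1 0 k l
  have l20 : ∀ k l, C 2 0 k l = -C 0 2 k l := fun k l => hl 2 0 k l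
  have l21 : ∀ k l, C 2 1 k l = -C 1 2 k l := fun k l => hl 2 1 k l
  have r10 : ∀ k l, C k l 1 0 = -C k l 0 1 := fun k l => hr k l 1 0
  have r20 : ∀ k l, C k l 2 0 = -C k l 0 2 := fun k l => hr k l 2 0
  have r21 : ∀ k l, C k l 2 1 = -C k l 1 2 := fun k l => hr k l 2 1
  have p1 : C 0 2 0 1 = C 0 1 0 2 := hp _ _ _ _
  have p2 : C 1 2 0 1 = C 0 1 1 2 := hp _ _ _ _
  have p3 : C 1 2 0 2 = C 0 2 1 2 := hp _ _ _ _
  have t00 := htr 0 0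
  have t01 := htr 0 1
  have t02 := htr 0 2
  have t11 := htr 1 1
  have t12 := htr 1 2
  have t22 := htr 2 2
  simp only [Fin.sum_univ_three, hll, hrr, l10, l20, l21, r10, r20, r21, p1, p2, p3, g10, g20,
    g21] at t00 t01 t02 t11 t12 t22
  rw [Matrix.det_fin_three, g10, g20, g21] at hdet
  have solve : ∀ x : ℝ, (G 0 0 * G 1 1 * G 2 2 - G 0 0 * G 1 2 * G 1 2 - G 0 1 * G 0 1 * G 2 2
      + G 0 1 * G 1 2 * G 0 2 + G 0 2 * G 0 1 * G 1 2 - G 0 2 * G 1 1 * G 0 2) * x = 0 → x = 0 :=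
    fun x hx => (mul_eq_zero.1 hx).resolve_left hdet
  -- With Ric the contraction of C, s its trace and indices raised by G, det(G) times the double
  -- dual of C is (s/2)G - Ric, minus the Einstein tensor. The coefficients in `c1` to `c6` are
  -- those of its six components; the factor -1 is the sign of the dual index pairs.
  have c1 : C 1 2 1 2 = 0 := solve _ (by
    linear_combination ((1 / 2) * G 0 0 * G 0 0 - G 0 0 * G 0 0) * t00
      + (G 0 1 * G 0 0 - G 0 0 * G 0 1 - G 0 1 * G 0 0) * t01
      + (G 0 2 * G 0 0 - G 0 0 * G 0 2 - G 0 2 * G 0 0) * t02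
      + ((1 / 2) * G 1 1 * G 0 0 - G 0 1 * G 0 1) * t11
      + (G 1 2 * G 0 0 - G 0 1 * G 0 2 - G 0 2 * G 0 1) * t12
      + ((1 / 2) * G 2 2 * G 0 0 - G 0 2 * G 0 2) * t22)
  have c2 : C 0 2 0 2 = 0 := solve _ (by
    linear_combination ((1 / 2) * G 0 0 * G 1 1 - G 0 1 * G 0 1) * t00
      + (G 0 1 * G 1 1 - G 0 1 * G 1 1 - G 1 1 * G 0 1) * t01
      + (G 0 2 * G 1 1 - G 0 1 * G 1 2 - G 1 2 * G 0 1) * t02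
      + ((1 / 2) * G 1 1 * G 1 1 - G 1 1 * G 1 1) * t11
      + (G 1 2 * G 1 1 - G 1 1 * G 1 2 - G 1 2 * G 1 1) * t12
      + ((1 / 2) * G 2 2 * G 1 1 - G 1 2 * G 1 2) * t22)
  have c3 : C 0 1 0 1 = 0 := solve _ (by
    linear_combination ((1 / 2) * G 0 0 * G 2 2 - G 0 2 * G 0 2) * t00
      + (G 0 1 * G 2 2 - G 0 2 * G 1 2 - G 1 2 * G 0 2) * t01
      + (G 0 2 * G 2 2 - G 0 2 * G 2 2 - G 2 2 * G 0 2) * t02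
      + ((1 / 2) * G 1 1 * G 2 2 - G 1 2 * G 1 2) * t11
      + (G 1 2 * G 2 2 - G 1 2 * G 2 2 - G 2 2 * G 1 2) * t12
      + ((1 / 2) * G 2 2 * G 2 2 - G 2 2 * G 2 2) * t22)
  have c4 : C 0 2 1 2 = 0 := solve _ (by
    linear_combination (-1 : ℝ) * (((1 / 2) * G 0 0 * G 0 1 - G 0 0 * G 0 1) * t00
      + (G 0 1 * G 0 1 - G 0 0 * G 1 1 - G 0 1 * G 0 1) * t01
      + (G 0 2 * G 0 1 - G 0 0 * G 1 2 - G 0 2 * G 0 1) * t02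
      + ((1 / 2) * G 1 1 * G 0 1 - G 0 1 * G 1 1) * t11
      + (G 1 2 * G 0 1 - G 0 1 * G 1 2 - G 0 2 * G 1 1) * t12
      + ((1 / 2) * G 2 2 * G 0 1 - G 0 2 * G 1 2) * t22))
  have c5 : C 0 1 1 2 = 0 := solve _ (by
    linear_combination ((1 / 2) * G 0 0 * G 0 2 - G 0 0 * G 0 2) * t00
      + (G 0 1 * G 0 2 - G 0 0 * G 1 2 - G 0 1 * G 0 2) * t01
      + (G 0 2 * G 0 2 - G 0 0 * G 2 2 - G 0 2 * G 0 2) * t02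
      + ((1 / 2) * G 1 1 * G 0 2 - G 0 1 * G 1 2) * t11
      + (G 1 2 * G 0 2 - G 0 1 * G 2 2 - G 0 2 * G 1 2) * t12
      + ((1 / 2) * G 2 2 * G 0 2 - G 0 2 * G 2 2) * t22)
  have c6 : C 0 1 0 2 = 0 := solve _ (by
    linear_combination (-1 : ℝ) * (((1 / 2) * G 0 0 * G 1 2 - G 0 1 * G 0 2) * t00
      + (G 0 1 * G 1 2 - G 0 1 * G 1 2 - G 1 1 * G 0 2) * t01
      + (G 0 2 * G 1 2 - G 0 1 * G 2 2 - G 1 2 * G 0 2) * t02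
      + ((1 / 2) * G 1 1 * G 1 2 - G 1 1 * G 1 2) * t11
      + (G 1 2 * G 1 2 - G 1 1 * G 2 2 - G 1 2 * G 1 2) * t12
      + ((1 / 2) * G 2 2 * G 1 2 - G 1 2 * G 2 2) * t22))
  funext i j k l
  fin_cases i <;> fin_cases j <;> fin_cases k <;> fin_cases l <;>
    simp only [Fin.zero_eta, Fin.mk_one, Fin.reduceFinMk, hll, hrr, l10, l20, l21, r10, r20, r21,
      p1, p2, p3, c1, c2, c3, c4, c5, c6, neg_zero, Pi.zero_apply]


/-- The Gram matrix of linearly independent vectors is positive definite. -/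
theorem posDef_gram {F ι : Type*} [Fintype ι] [AddCommGroup F] [Module ℝ F] [TopologicalSpace F]
    (b : F →L[ℝ] F →L[ℝ] ℝ) (hs : ∀ v w, b v w = b w v) (hb : ∀ v, v ≠ 0 → 0 < b v v)
    {c : ι → F} (hc : LinearIndependent ℝ c) :
    (Matrix.of fun i j => b (c i) (c j)).PosDef := by
  refine Matrix.PosDef.of_dotProduct_mulVec_pos ?_ fun v hv => ?_
  · ext i j
    exact hs _ _
  · have h0 : ∑ i, v i • c i ≠ 0 := fun h =>
      hv (funext (Fintype.linearIndependent_iff.1 hc v h))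
    refine (hb _ h0).trans_eq ?_
    simp only [map_sum, map_smul, FunLike.coe_sum, Finset.sum_apply, FunLike.coe_smul,
      Pi.smul_apply, smul_eq_mul, dotProduct, Matrix.mulVec, Matrix.of_apply, star_trivial,
      Finset.mul_sum]
    exact Finset.sum_congr rfl fun i _ => Finset.sum_congr rfl fun j _ => by
      rw [hs (c j)]; ring

namespace SplitSpacetime

variable {M : Type*} [TopologicalSpace M] [ChartedSpace E3 M] (X : SplitSpacetime M)

/-! ### The coordinate domain and the metric in coordinates -/

theorem uniqueDiffOn_I : UniqueDiffOn ℝ X.I :=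
  uniqueDiffOn_convex X.ordConnected.convex X.nonempty_interior

theorem uniqueDiffOn_dom (φ : OpenPartialHomeomorph M E3) : UniqueDiffOn ℝ (X.dom φ) :=
  X.uniqueDiffOn_I.prod φ.open_target.uniqueDiffOn

/-- An interval with nonempty interior lies in the closure of its interior; this makes mixed
derivatives commute also at its end points. -/
theorem dom_subset_closure_interior (φ : OpenPartialHomeomorph M E3) :
    X.dom φ ⊆ closure (interior (X.dom φ)) := by
  rw [dom, interior_prod_eq, closure_prod_eq, φ.open_target.interior_eq,
    (X.ordConnected.convex (𝕜 := ℝ)).closure_interior_eq_closure_of_nonempty_interior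
      X.nonempty_interior]
  exact Set.prod_mono subset_closure subset_closure

theorem coordFrame_injective [IsManifold (𝓡 3) ∞ M] {φ : OpenPartialHomeomorph M E3}
    (hφ : φ ∈ IsManifold.maximalAtlas (𝓡 3) ∞ M) {y : E3} (hy : y ∈ φ.target) :
    Function.Injective (mfderiv (𝓡 3) (𝓡 3) φ.symm y) := by
  have h1 : φ ∈ IsManifold.maximalAtlas (𝓡 3) 1 M :=
    IsManifold.maximalAtlas_subset_of_le (by exact_mod_cast le_top) hφ
  have : IsManifold (𝓡 3) 1 M := IsManifold.of_le (n := ∞) (by exact_mod_cast le_top)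
  have hd : φ.MDifferentiable (𝓡 3) (𝓡 3) :=
    ⟨fun x hx => (mdifferentiableAt_of_mem_maximalAtlas h1 hx).mdifferentiableWithinAt,
      fun x hx => (mdifferentiableAt_symm_of_mem_maximalAtlas h1 hx).mdifferentiableWithinAt⟩
  exact hd.symm.mfderiv_injective hy

section Chart

variable {X} {φ : OpenPartialHomeomorph M E3} {p : ℝ × E3}

theorem N_pos (hp : p ∈ X.dom φ) : 0 < X.N φ p := X.lapse_pos _ hp.1 _

theorem transpose_g (hp : p ∈ X.dom φ) : (X.g φ p).transpose = X.g φ p := by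
  ext i j
  exact X.metric_symm _ hp.1 _ _ _

theorem posDef_g [IsManifold (𝓡 3) ∞ M] (hφ : φ ∈ IsManifold.maximalAtlas (𝓡 3) ∞ M)
    (hp : p ∈ X.dom φ) : (X.g φ p).PosDef := by
  refine posDef_gram (X.metric p.1 (φ.symm p.2)) (X.metric_symm _ hp.1 _)
    (X.metric_pos _ hp.1 _) ?_
  have hb := (EuclideanSpace.basisFun (Fin 3) ℝ).toBasis.linearIndependent
  have := hb.map' (mfderiv (𝓡 3) (𝓡 3) φ.symm p.2).toLinearMap
    (LinearMap.ker_eq_bot.2 (coordFrame_injective hφ hp.2))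
  have e : coordFrame φ p.2 = (mfderiv (𝓡 3) (𝓡 3) φ.symm p.2).toLinearMap ∘
      (EuclideanSpace.basisFun (Fin 3) ℝ).toBasis := by
    funext i
    have hi : EuclideanSpace.single i (1 : ℝ) = (EuclideanSpace.basisFun (Fin 3) ℝ).toBasis i := by
      simp
    exact congrArg (mfderiv (𝓡 3) (𝓡 3) φ.symm p.2) hi
  change LinearIndependent ℝ (coordFrame φ p.2)
  rw [e]
  exact this

theorem isUnit_det_g [IsManifold (𝓡 3) ∞ M] (hφ : φ ∈ IsManifold.maximalAtlas (𝓡 3) ∞ M)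
    (hp : p ∈ X.dom φ) : IsUnit (X.g φ p).det :=
  (posDef_g hφ hp).det_pos.ne'.isUnit

theorem smoothMat_g (hφ : φ ∈ IsManifold.maximalAtlas (𝓡 3) ∞ M) :
    SmoothMat (X.dom φ) (X.g φ) := X.metric_smooth φ hφ

theorem contDiffOn_N (hφ : φ ∈ IsManifold.maximalAtlas (𝓡 3) ∞ M) :
    ContDiffOn ℝ ∞ (X.N φ) (X.dom φ) := X.lapse_smooth φ hφ

theorem smoothMat_γ (hφ : φ ∈ IsManifold.maximalAtlas (𝓡 3) ∞ M) :
    SmoothMat (X.dom φ) (X.γ φ) := by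
  intro a b
  induction a using Fin.cases <;> induction b using Fin.cases
  · exact ((contDiffOn_N hφ).pow 2).neg
  · exact contDiffOn_const
  · exact contDiffOn_const
  · exact smoothMat_g hφ _ _

theorem isSmoothMetric_γ [IsManifold (𝓡 3) ∞ M] (hφ : φ ∈ IsManifold.maximalAtlas (𝓡 3) ∞ M) :
    IsSmoothMetric (X.dom φ) (X.γ φ) where
  uniqueDiffOn := X.uniqueDiffOn_dom φ
  subset_closure := X.dom_subset_closure_interior φ
  smooth := smoothMat_γ hφ
  symm q hq := by rw [γ, transpose_splitMatrix, transpose_g hq]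
  det_ne q hq := by
    rw [γ, det_splitMatrix]
    exact mul_ne_zero (neg_ne_zero.2 (pow_ne_zero _ (N_pos hq).ne')) (posDef_g hφ hq).det_pos.ne'

theorem inv_γ [IsManifold (𝓡 3) ∞ M] (hφ : φ ∈ IsManifold.maximalAtlas (𝓡 3) ∞ M)
    (hp : p ∈ X.dom φ) : (X.γ φ p)⁻¹ = splitMatrix (-((X.N φ p) ^ 2)⁻¹) (X.g φ p)⁻¹ := by
  rw [γ, inv_splitMatrix (neg_ne_zero.2 (pow_ne_zero _ (N_pos hp).ne')) (isUnit_det_g hφ hp),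
    inv_neg]

theorem transpose_inv_g (hp : p ∈ X.dom φ) : ((X.g φ p)⁻¹).transpose = (X.g φ p)⁻¹ := by
  rw [Matrix.transpose_nonsing_inv, transpose_g hp]

theorem weyl_zero_succ (hp : p ∈ X.dom φ) (i j : Fin 3) :
    X.W φ p 0 i.succ 0 j.succ = X.N φ p ^ 2 * X.E φ p i j := by
  have hN := (N_pos hp).ne'
  simp only [E, Matrix.of_apply]
  field_simp

end Chart

end SplitSpacetime

/-! ### The decomposition of the curvature tensor -/

section Decomposition

theorem kn_antisymm_left (X Y : Matrix (Fin 4) (Fin 4) ℝ) (a b c d : Fin 4) :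
    kn X Y a b c d = -kn X Y b a c d := by
  simp only [kn]
  ring

theorem kn_antisymm_right (X Y : Matrix (Fin 4) (Fin 4) ℝ) (a b c d : Fin 4) :
    kn X Y a b c d = -kn X Y a b d c := by
  simp only [kn]
  ring

theorem kn_pair_symm {X Y : Matrix (Fin 4) (Fin 4) ℝ} (hX : X.transpose = X)
    (hY : Y.transpose = Y) (a b c d : Fin 4) : kn X Y a b c d = kn X Y c d a b := by
  have hx : ∀ i j, X i j = X j i := fun i j => congrFun (congrFun hX j) i
  have hy : ∀ i j, Y i j = Y j i := fun i j => congrFun (congrFun hY j) i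
  simp only [kn, hx c a, hx d b, hx c b, hx d a, hy c a, hy d b, hy c b, hy d a]
  ring

/-- The Ricci contraction of a Kulkarni-Nomizu product with the metric. -/
theorem sum_inv_mul_kn {m : Matrix (Fin 4) (Fin 4) ℝ} (hm : m.transpose = m)
    (hdet : IsUnit m.det) (X : Matrix (Fin 4) (Fin 4) ℝ) (b d : Fin 4) :
    ∑ a, ∑ c, m⁻¹ a c * kn X m a b c d
      = (∑ a, ∑ c, m⁻¹ a c * X a c) * m b d + 2 * X b d := by
  have hm' : ∀ i j, m i j = m j i := fun i j => congrFun (congrFun hm j) i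
  have hi : ∀ i j, m⁻¹ i j = m⁻¹ j i := by
    have : (m⁻¹).transpose = m⁻¹ := by rw [Matrix.transpose_nonsing_inv, hm]
    exact fun i j => congrFun (congrFun this j) i
  have h1 : ∀ a b, ∑ c, m⁻¹ a c * m c b = (1 : Matrix (Fin 4) (Fin 4) ℝ) a b := by
    intro a b
    rw [← Matrix.mul_apply, Matrix.nonsing_inv_mul _ hdet]
  have e : ∀ a c, m⁻¹ a c * kn X m a b c d = m⁻¹ a c * X a c * m b d
      + X b d * (m⁻¹ a c * m c a) - X a d * (m⁻¹ a c * m c b) - X b c * (m⁻¹ c a * m a d) := by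
    intro a c
    rw [hm' c a, hi c a, hm' c b]
    simp only [kn]
    ring
  simp only [e, Finset.sum_sub_distrib, Finset.sum_add_distrib]
  rw [Finset.sum_comm (f := fun a c => X b c * (m⁻¹ c a * m a d))]
  simp only [← Finset.mul_sum, ← Finset.sum_mul, h1, Matrix.one_apply]
  simp
  ring

variable {D : Set (ℝ × E3)} {γ : ℝ × E3 → Matrix (Fin 4) (Fin 4) ℝ} {p : ℝ × E3}

theorem schouten4_eq_kn (p : ℝ × E3) :
    schouten4 D γ p = (1 / 2 : ℝ) • kn (schouten D γ p) (γ p) := by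
  funext a b c d
  simp only [schouten4, kn, Pi.smul_apply, smul_eq_mul]
  ring

theorem riemann_eq_weyl_add (p : ℝ × E3) :
    riemann D γ p = weyl D γ p + schouten4 D γ p := by
  funext a b c d
  simp only [Pi.add_apply, weyl, schouten4, schouten, Matrix.sub_apply, Matrix.smul_apply,
    smul_eq_mul]
  ring

theorem curvMat_eq_inv_mul (hdet : IsUnit (γ p).det) (a b c d : Fin 4) :
    curvMat D γ c d p a b = ∑ l, (γ p)⁻¹ a l * riemann D γ p l b c d := by
  simp only [riemann_eq_mul]
  rw [← Matrix.mul_apply, Matrix.nonsing_inv_mul_cancel_left _ _ hdet]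

theorem weyl_eq_sub_kn (p : ℝ × E3) :
    weyl D γ p = riemann D γ p - (1 / 2 : ℝ) • kn (schouten D γ p) (γ p) := by
  rw [← schouten4_eq_kn, riemann_eq_weyl_add, add_sub_cancel_right]

namespace IsSmoothMetric

theorem weyl_antisymm_left (hγ : IsSmoothMetric D γ) (hp : p ∈ D) (a b c d : Fin 4) :
    weyl D γ p a b c d = -weyl D γ p b a c d := by
  simp only [weyl_eq_sub_kn, Pi.sub_apply, Pi.smul_apply, smul_eq_mul]
  rw [hγ.riemann_antisymm_left hp, kn_antisymm_left]
  ring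

theorem weyl_antisymm_right (a b c d : Fin 4) :
    weyl D γ p a b c d = -weyl D γ p a b d c := by
  simp only [weyl_eq_sub_kn, Pi.sub_apply, Pi.smul_apply, smul_eq_mul]
  rw [riemann_antisymm_right, kn_antisymm_right]
  ring

/-- Symmetry of the Schouten tensor is kept as a hypothesis; for a perfect fluid it is read off from
the field equation in `transpose_schouten`. -/
theorem weyl_pair_symm (hγ : IsSmoothMetric D γ) (hp : p ∈ D)
    (hS : (schouten D γ p).transpose = schouten D γ p) (a b c d : Fin 4) :
    weyl D γ p a b c d = weyl D γ p c d a b := by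
  simp only [weyl_eq_sub_kn, Pi.sub_apply, Pi.smul_apply, smul_eq_mul]
  rw [hγ.riemann_pair_symm hp, kn_pair_symm hS (hγ.symm p hp)]

/-- The Weyl tensor is trace-free. -/
theorem sum_inv_mul_weyl (hγ : IsSmoothMetric D γ) (hp : p ∈ D) (b d : Fin 4) :
    ∑ a, ∑ c, (γ p)⁻¹ a c * weyl D γ p a b c d = 0 := by
  have hdet := hγ.isUnit_det hp
  have hinv : ∀ i j, (γ p)⁻¹ i j = (γ p)⁻¹ j i := by
    have : ((γ p)⁻¹).transpose = (γ p)⁻¹ := by rw [Matrix.transpose_nonsing_inv, hγ.symm p hp]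
    exact fun i j => congrFun (congrFun this j) i
  have hric : ∑ a, ∑ c, (γ p)⁻¹ a c * riemann D γ p a b c d = ricci D γ p b d := by
    rw [Finset.sum_comm]
    have : ∀ c, riemannUp D γ c b c d p = ∑ a, (γ p)⁻¹ a c * riemann D γ p a b c d := by
      intro c
      refine (curvMat_eq_inv_mul hdet c b c d).trans ?_
      exact Finset.sum_congr rfl fun a _ => by rw [hinv]
    simp only [ricci, Matrix.of_apply, this]
  -- In dimension four the trace is R - 4R/6 = R/3.
  have htr : ∑ a, ∑ c, (γ p)⁻¹ a c * schouten D γ p a c = scalarCurv D γ p / 3 := by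
    have h4 : ∑ a, ∑ c, (γ p)⁻¹ a c * γ p a c = 4 := by
      have : ((γ p)⁻¹ * γ p).trace = 4 := by
        rw [Matrix.nonsing_inv_mul _ hdet, Matrix.trace_one]
        simp
      rw [← this, ← Matrix.trace_transpose]
      simp only [Matrix.trace, Matrix.diag_apply, Matrix.transpose_apply, Matrix.mul_apply]
      refine Finset.sum_congr rfl fun a _ => Finset.sum_congr rfl fun c _ => ?_
      rw [show γ p a c = γ p c a from congrFun (congrFun (hγ.symm p hp) c) a]
    have : ∀ a c, (γ p)⁻¹ a c * schouten D γ p a c = (γ p)⁻¹ a c * ricci D γ p a c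
        - scalarCurv D γ p / 6 * ((γ p)⁻¹ a c * γ p a c) := by
      intro a c
      simp only [schouten, Matrix.sub_apply, Matrix.smul_apply, smul_eq_mul]
      ring
    simp only [this, Finset.sum_sub_distrib, ← Finset.mul_sum, h4]
    change scalarCurv D γ p - _ = _
    ring
  have : ∀ a c, (γ p)⁻¹ a c * weyl D γ p a b c d = (γ p)⁻¹ a c * riemann D γ p a b c d
      - (1 / 2) * ((γ p)⁻¹ a c * kn (schouten D γ p) (γ p) a b c d) := by
    intro a c
    simp only [weyl_eq_sub_kn, Pi.sub_apply, Pi.smul_apply, smul_eq_mul]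
    ring
  simp only [this, Finset.sum_sub_distrib, ← Finset.mul_sum]
  rw [hric, sum_inv_mul_kn (hγ.symm p hp) hdet, htr]
  simp only [schouten, Matrix.sub_apply, Matrix.smul_apply, smul_eq_mul]
  ring

end IsSmoothMetric

end Decomposition

/-! ### The curvature of a purely electric perfect fluid -/

namespace SplitSpacetime

variable {M : Type*} [TopologicalSpace M] [ChartedSpace E3 M] (X : SplitSpacetime M)

/-- The mixed components `W_{Ti T}{}^j`. -/
def Emix (φ : OpenPartialHomeomorph M E3) (p : ℝ × E3) : Matrix (Fin 3) (Fin 3) ℝ :=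
  (X.g φ p)⁻¹ * X.E φ p

variable {X} {mass press : ℝ → M → ℝ} {φ : OpenPartialHomeomorph M E3} {p : ℝ × E3}
  [IsManifold (𝓡 3) ∞ M]

/-- Trace of the Einstein equation: R - 2R = -M + 3P. -/
theorem scalarCurv_eq (hF : X.IsPerfectFluid mass press)
    (hφ : φ ∈ IsManifold.maximalAtlas (𝓡 3) ∞ M) (hp : p ∈ X.dom φ) :
    scalarCurv (X.dom φ) (X.γ φ) p = inCoord φ mass p - 3 * inCoord φ press p := by
  have h := congrArg (fun Q => ((X.γ φ p)⁻¹ * Q).trace) (hF φ hφ p hp)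
  have hsym : ((X.γ φ p)⁻¹).transpose = (X.γ φ p)⁻¹ := by
    rw [Matrix.transpose_nonsing_inv, (isSmoothMetric_γ hφ).symm p hp]
  have hs : ((X.γ φ p)⁻¹ * ricci (X.dom φ) (X.γ φ) p).trace
      = scalarCurv (X.dom φ) (X.γ φ) p := by
    rw [← hsym]
    simp only [Matrix.trace, Matrix.diag_apply, Matrix.mul_apply, Matrix.transpose_apply,
      scalarCurv]
    rw [Finset.sum_comm]
  have hN := (N_pos hp).ne'
  simp only [Matrix.mul_sub, Matrix.mul_smul, Matrix.trace_sub, Matrix.trace_smul, hs] at h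
  rw [Matrix.nonsing_inv_mul _ ((isSmoothMetric_γ hφ).isUnit_det hp), inv_γ hφ hp,
    splitMatrix_mul, trace_splitMatrix, Matrix.mul_smul,
    Matrix.nonsing_inv_mul _ (isUnit_det_g hφ hp)] at h
  simp only [Matrix.trace_one, Matrix.trace_smul, Fintype.card_fin, smul_eq_mul] at h
  field_simp at h
  push_cast at h
  linarith

/-- The Schouten tensor is the stress-energy tensor plus (R/3)γ, with R = M - 3P. -/
theorem schouten_eq (hF : X.IsPerfectFluid mass press)
    (hφ : φ ∈ IsManifold.maximalAtlas (𝓡 3) ∞ M) (hp : p ∈ X.dom φ) :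
    schouten (X.dom φ) (X.γ φ) p
      = splitMatrix (X.N φ p ^ 2 * (2 / 3 * inCoord φ mass p + inCoord φ press p))
        ((inCoord φ mass p / 3) • X.g φ p) := by
  have h := hF φ hφ p hp
  have hs := scalarCurv_eq hF hφ hp
  have : schouten (X.dom φ) (X.γ φ) p = (ricci (X.dom φ) (X.γ φ) p
      - (scalarCurv (X.dom φ) (X.γ φ) p / 2) • X.γ φ p)
      + (scalarCurv (X.dom φ) (X.γ φ) p / 3) • X.γ φ p := by
    rw [schouten]
    module
  rw [this, h, γ, splitMatrix_smul, splitMatrix_add, hs]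
  congr 1
  · ring
  · module

theorem transpose_schouten (hF : X.IsPerfectFluid mass press)
    (hφ : φ ∈ IsManifold.maximalAtlas (𝓡 3) ∞ M) (hp : p ∈ X.dom φ) :
    (schouten (X.dom φ) (X.γ φ) p).transpose = schouten (X.dom φ) (X.γ φ) p := by
  rw [schouten_eq hF hφ hp, transpose_splitMatrix, Matrix.transpose_smul, transpose_g hp]

theorem transpose_E (hF : X.IsPerfectFluid mass press)
    (hφ : φ ∈ IsManifold.maximalAtlas (𝓡 3) ∞ M) (hp : p ∈ X.dom φ) :
    (X.E φ p).transpose = X.E φ p := by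
  ext i j
  simp only [E, Matrix.transpose_apply, Matrix.of_apply]
  congr 1
  exact (isSmoothMetric_γ hφ).weyl_pair_symm hp (transpose_schouten hF hφ hp) _ _ _ _

/-- The tt component of the trace of W vanishes, and W_{tttt} = 0 leaves only the spatial trace of
`E`. -/
theorem trace_Emix (hφ : φ ∈ IsManifold.maximalAtlas (𝓡 3) ∞ M) (hp : p ∈ X.dom φ) :
    (X.Emix φ p).trace = 0 := by
  have hγ := isSmoothMetric_γ (X := X) hφ
  have h := hγ.sum_inv_mul_weyl hp 0 0
  have h00 : ∀ c d, weyl (X.dom φ) (X.γ φ) p 0 0 c d = 0 := fun c d => by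
    linarith [hγ.weyl_antisymm_left hp 0 0 c d]
  have hij : ∀ i j : Fin 3, weyl (X.dom φ) (X.γ φ) p i.succ 0 j.succ 0
      = X.N φ p ^ 2 * X.E φ p i j := fun i j => by
    rw [hγ.weyl_antisymm_left hp, IsSmoothMetric.weyl_antisymm_right, neg_neg]
    exact weyl_zero_succ hp i j
  rw [inv_γ hφ hp] at h
  simp only [Fin.sum_univ_succ (n := 3), splitMatrix_zero_zero, splitMatrix_zero_succ,
    splitMatrix_succ_zero, splitMatrix_succ_succ, h00, hij, mul_zero, zero_mul, zero_add,
    Finset.sum_const_zero] at h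
  have hN := (N_pos hp).ne'
  rw [Emix, ← transpose_inv_g hp]
  simp only [Matrix.trace, Matrix.diag_apply, Matrix.mul_apply, Matrix.transpose_apply]
  rw [Finset.sum_comm]
  simp only [mul_left_comm _ (X.N φ p ^ 2), ← Finset.mul_sum] at h
  exact (mul_eq_zero.1 h).resolve_left (pow_ne_zero _ hN)

/-- The Weyl tensor of a purely electric perfect fluid is determined by its electric part. -/
theorem weyl_eq_kn (hF : X.IsPerfectFluid mass press) (hE : X.IsPurelyElectric)
    (hφ : φ ∈ IsManifold.maximalAtlas (𝓡 3) ∞ M) (hp : p ∈ X.dom φ) :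
    X.W φ p = kn (splitMatrix 0 (X.E φ p)) (X.γbar φ p) := by
  have hγ := isSmoothMetric_γ (X := X) hφ
  have hS := transpose_schouten hF hφ hp
  have hN := (N_pos hp).ne'
  have wl : ∀ a b c d, X.W φ p a b c d = -X.W φ p b a c d := hγ.weyl_antisymm_left hp
  have wr : ∀ a b c d, X.W φ p a b c d = -X.W φ p a b d c :=
    fun a b c d => IsSmoothMetric.weyl_antisymm_right a b c d
  have ws : ∀ a b c d, X.W φ p a b c d = X.W φ p c d a b := hγ.weyl_pair_symm hp hS
  have z1 : ∀ c d, X.W φ p 0 0 c d = 0 := fun c d => by linarith [wl 0 0 c d]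
  have z2 : ∀ c d, X.W φ p c d 0 0 = 0 := fun c d => by linarith [wr c d 0 0]
  have m1 : ∀ i j k : Fin 3, X.W φ p 0 i.succ j.succ k.succ = 0 := fun i j k =>
    (mul_eq_zero.1 (hE φ hφ p hp i j k)).resolve_left (inv_ne_zero hN)
  have m2 : ∀ i j k : Fin 3, X.W φ p i.succ 0 j.succ k.succ = 0 := fun i j k => by
    rw [wl, m1, neg_zero]
  have m3 : ∀ i j k : Fin 3, X.W φ p j.succ k.succ 0 i.succ = 0 := fun i j k => by rw [ws, m1]
  have m4 : ∀ i j k : Fin 3, X.W φ p j.succ k.succ i.succ 0 = 0 := fun i j k => by rw [ws, m2]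
  have e1 : ∀ i j : Fin 3, X.W φ p 0 i.succ 0 j.succ = X.N φ p ^ 2 * X.E φ p i j :=
    fun i j => weyl_zero_succ hp i j
  have e2 : ∀ i j : Fin 3, X.W φ p i.succ 0 0 j.succ = -(X.N φ p ^ 2 * X.E φ p i j) :=
    fun i j => by rw [wl, e1]
  have e3 : ∀ i j : Fin 3, X.W φ p 0 i.succ j.succ 0 = -(X.N φ p ^ 2 * X.E φ p i j) :=
    fun i j => by rw [wr, e1]
  have e4 : ∀ i j : Fin 3, X.W φ p i.succ 0 j.succ 0 = X.N φ p ^ 2 * X.E φ p i j :=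
    fun i j => by rw [wl, e3, neg_neg]
  have hgs : ∀ i j, X.g φ p i j = X.g φ p j i := fun i j => congrFun (congrFun (transpose_g hp) j) i
  have hEs : ∀ i j, X.E φ p i j = X.E φ p j i :=
    fun i j => congrFun (congrFun (transpose_E hF hφ hp) j) i
  have hgi : ∀ i j, (X.g φ p)⁻¹ i j = (X.g φ p)⁻¹ j i :=
    fun i j => congrFun (congrFun (transpose_inv_g hp) j) i
  have hgg : ∀ i j, ∑ k, (X.g φ p)⁻¹ i k * X.g φ p k j = (1 : Matrix (Fin 3) (Fin 3) ℝ) i j := by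
    intro i j
    rw [← Matrix.mul_apply, Matrix.nonsing_inv_mul _ (isUnit_det_g hφ hp)]
  -- The full trace of W is zero and γ^{tt} = -N⁻², so the spatial contraction must compensate the
  -- term -E.
  have hsp : ∀ j l : Fin 3, ∑ i : Fin 3, ∑ k : Fin 3, (X.g φ p)⁻¹ i k *
      X.W φ p i.succ j.succ k.succ l.succ = X.E φ p j l := by
    intro j l
    have h := hγ.sum_inv_mul_weyl hp j.succ l.succ
    rw [inv_γ hφ hp] at h
    change ∑ a, ∑ c, _ * X.W φ p a j.succ c l.succ = 0 at h
    simp only [Fin.sum_univ_succ (n := 3), splitMatrix_zero_zero, splitMatrix_zero_succ,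
      splitMatrix_succ_zero, splitMatrix_succ_succ, e1, zero_mul, zero_add,
      Finset.sum_const_zero, add_zero] at h
    have : -(X.N φ p ^ 2)⁻¹ * (X.N φ p ^ 2 * X.E φ p j l) = -X.E φ p j l := by
      field_simp
    rw [this] at h
    linarith
  have htr : ∑ i, ∑ k, (X.g φ p)⁻¹ i k * X.E φ p i k = 0 := by
    have := trace_Emix (X := X) hφ hp
    rw [Emix, ← transpose_inv_g hp] at this
    simp only [Matrix.trace, Matrix.diag_apply, Matrix.mul_apply, Matrix.transpose_apply] at this
    rw [Finset.sum_comm]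
    exact this
  -- The spatial contraction of the product of E with g is (tr E)g + 3E - 2E = E, as tr E = 0. It
  -- agrees with that of W by `hsp`, so dimension three forces the two tensors to coincide.
  have hspat := eq_zero_of_contraction_eq_zero (transpose_inv_g hp)
    ((Matrix.isUnit_nonsing_inv_det _ (isUnit_det_g (X := X) hφ hp)).ne_zero)
    (C := fun i j k l => X.W φ p i.succ j.succ k.succ l.succ
      - kn (splitMatrix 0 (X.E φ p)) (X.γbar φ p) i.succ j.succ k.succ l.succ)
    (fun i j k l => by rw [wl, kn_antisymm_left]; ring)
    (fun i j k l => by rw [wr, kn_antisymm_right]; ring)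
    (fun i j k l => by
      rw [ws, kn_pair_symm]
      · rw [transpose_splitMatrix, transpose_E hF hφ hp]
      · rw [γbar, transpose_splitMatrix, transpose_g hp])
    (by
      intro j l
      have e : ∀ i k : Fin 3, (X.g φ p)⁻¹ i k * (X.W φ p i.succ j.succ k.succ l.succ
          - kn (splitMatrix 0 (X.E φ p)) (X.γbar φ p) i.succ j.succ k.succ l.succ)
          = (X.g φ p)⁻¹ i k * X.W φ p i.succ j.succ k.succ l.succ
            - (X.g φ p)⁻¹ i k * X.E φ p i k * X.g φ p j l
            - X.E φ p j l * ((X.g φ p)⁻¹ i k * X.g φ p k i)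
            + X.E φ p i l * ((X.g φ p)⁻¹ i k * X.g φ p k j)
            + X.E φ p j k * ((X.g φ p)⁻¹ k i * X.g φ p i l) := by
        intro i k
        rw [hgs k i, hgi k i, hgs k j]
        simp only [kn, γbar, splitMatrix_succ_succ]
        ring
      simp only [e, Finset.sum_sub_distrib, Finset.sum_add_distrib]
      rw [Finset.sum_comm (f := fun i k => X.E φ p j k * ((X.g φ p)⁻¹ k i * X.g φ p i l)), hsp]
      simp only [← Finset.mul_sum, ← Finset.sum_mul, hgg, htr, Matrix.one_apply]
      simp
      ring)
  funext a b c d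
  induction a using Fin.cases <;> induction b using Fin.cases <;> induction c using Fin.cases <;>
    induction d using Fin.cases
  any_goals simp [kn, γbar, z1, z2, m1, m2, m3, m4, e1, e2, e3, e4]
  any_goals exact mul_comm _ _
  rename_i i j k l
  have := congrFun (congrFun (congrFun (congrFun hspat i) j) k) l
  simp only [kn, γbar, splitMatrix_succ_succ, Pi.zero_apply] at this
  linarith

end SplitSpacetime

-- Factor L = CᵀC. Then tr(LSLS) = tr(TᵀT) for the symmetric matrix T = C S Cᵀ, and T ≠ 0 because C
-- is invertible.
open scoped MatrixOrder in
theorem trace_mul_self_pos {n : Type*} [Fintype n] [DecidableEq n] {L S : Matrix n n ℝ}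
    (hL : L.PosDef) (hS : S.transpose = S) (h0 : S ≠ 0) : 0 < ((L * S) * (L * S)).trace := by
  obtain ⟨C, hC⟩ := CStarAlgebra.nonneg_iff_eq_star_mul_self.mp hL.posSemidef.nonneg
  have hC' : L = C.transpose * C := hC
  have hu : IsUnit C := by
    have := hL.isUnit
    rw [hC'] at this
    rw [Matrix.isUnit_iff_isUnit_det] at this ⊢
    rw [Matrix.det_mul] at this
    exact isUnit_of_mul_isUnit_right this
  set T := C * S * C.transpose with hT
  have hTt : T.transpose = T := by
    simp only [hT, Matrix.transpose_mul, Matrix.transpose_transpose, hS, Matrix.mul_assoc]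
  have e : ((L * S) * (L * S)).trace = (T.transpose * T).trace := by
    have hTT : T * T = (C * S * C.transpose * C * S) * C.transpose := by
      simp only [hT, Matrix.mul_assoc]
    rw [hTt, hTT, Matrix.trace_mul_comm (C * S * C.transpose * C * S), hC']
    simp only [Matrix.mul_assoc]
  have hT0 : T ≠ 0 := by
    intro h
    apply h0
    have hd : IsUnit C.det := (Matrix.isUnit_iff_isUnit_det C).1 hu
    have hdt : IsUnit C.transpose.det := by rwa [Matrix.det_transpose]
    calc S = C⁻¹ * (C * S * C.transpose) * C.transpose⁻¹ := by
          rw [Matrix.mul_assoc C, Matrix.nonsing_inv_mul_cancel_left _ _ hd,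
            Matrix.mul_nonsing_inv_cancel_right _ _ hdt]
      _ = 0 := by rw [← hT, h]; simp
  rw [e]
  refine lt_of_le_of_ne ?_ fun h => hT0 (Matrix.trace_conjTranspose_mul_self_eq_zero_iff.1 h.symm)
  exact (Matrix.posSemidef_conjTranspose_mul_self T).trace_nonneg

namespace SplitSpacetime

variable {M : Type*} [TopologicalSpace M] [ChartedSpace E3 M] {X : SplitSpacetime M}
  {mass press : ℝ → M → ℝ} {φ : OpenPartialHomeomorph M E3} {p : ℝ × E3}

theorem R_eq_add (p : ℝ × E3) : X.R φ p = X.W φ p + X.A φ p := riemann_eq_weyl_add p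

/-- A sign σ with σ² = 1 in front of N² covers `γ` and `γbar` at once, so each norm is computed a
single time. -/
theorem γ_eq_split (p : ℝ × E3) : X.γ φ p = splitMatrix (-1 * X.N φ p ^ 2) (X.g φ p) := by
  rw [γ, neg_one_mul]

theorem γbar_eq_split (p : ℝ × E3) : X.γbar φ p = splitMatrix (1 * X.N φ p ^ 2) (X.g φ p) := by
  rw [γbar, one_mul]

theorem transpose_split_g (hp : p ∈ X.dom φ) (u v : ℝ) :
    (splitMatrix u (v • X.g φ p)).transpose = splitMatrix u (v • X.g φ p) := by
  rw [transpose_splitMatrix, Matrix.transpose_smul, transpose_g hp]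

theorem transpose_γ (hp : p ∈ X.dom φ) : (X.γ φ p).transpose = X.γ φ p := by
  rw [γ, transpose_splitMatrix, transpose_g hp]

theorem transpose_γbar (hp : p ∈ X.dom φ) : (X.γbar φ p).transpose = X.γbar φ p := by
  rw [γbar, transpose_splitMatrix, transpose_g hp]

variable [IsManifold (𝓡 3) ∞ M]

theorem A_eq_kn (hF : X.IsPerfectFluid mass press)
    (hφ : φ ∈ IsManifold.maximalAtlas (𝓡 3) ∞ M) (hp : p ∈ X.dom φ) :
    X.A φ p = (1 / 2 : ℝ) • kn (splitMatrix
      (X.N φ p ^ 2 * (2 / 3 * inCoord φ mass p + inCoord φ press p))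
        ((inCoord φ mass p / 3) • X.g φ p)) (X.γ φ p) := by
  rw [← schouten_eq hF hφ hp]
  exact schouten4_eq_kn p

/-! ### The norms of the curvature tensors -/

section Norms

theorem inv_split_mul (hφ : φ ∈ IsManifold.maximalAtlas (𝓡 3) ∞ M) (hp : p ∈ X.dom φ) {σ : ℝ}
    (hσ : σ * σ = 1) (u : ℝ) (s : Matrix (Fin 3) (Fin 3) ℝ) :
    (splitMatrix (σ * X.N φ p ^ 2) (X.g φ p))⁻¹ * splitMatrix (X.N φ p ^ 2 * u) s
      = splitMatrix (σ * u) ((X.g φ p)⁻¹ * s) := by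
  have hN := (N_pos hp).ne'
  have h0 : σ ≠ 0 := left_ne_zero_of_mul (hσ ▸ one_ne_zero)
  rw [inv_splitMatrix (mul_ne_zero h0 (pow_ne_zero _ hN)) (isUnit_det_g hφ hp), splitMatrix_mul]
  congr 1
  field_simp
  linear_combination -u * hσ

theorem inv_split_mul_E (hφ : φ ∈ IsManifold.maximalAtlas (𝓡 3) ∞ M) (hp : p ∈ X.dom φ) {σ : ℝ}
    (hσ : σ * σ = 1) : (splitMatrix (σ * X.N φ p ^ 2) (X.g φ p))⁻¹ * splitMatrix 0 (X.E φ p)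
      = splitMatrix 0 (X.Emix φ p) := by
  simpa [Emix] using inv_split_mul hφ hp hσ 0 (X.E φ p)

theorem inv_split_mul_γbar (hφ : φ ∈ IsManifold.maximalAtlas (𝓡 3) ∞ M) (hp : p ∈ X.dom φ) {σ : ℝ}
    (hσ : σ * σ = 1) : (splitMatrix (σ * X.N φ p ^ 2) (X.g φ p))⁻¹ * X.γbar φ p
      = splitMatrix σ 1 := by
  have := inv_split_mul hφ hp hσ 1 (X.g φ p)
  rwa [mul_one, mul_one, Matrix.nonsing_inv_mul _ (isUnit_det_g hφ hp)] at this

theorem inv_split_mul_γ (hφ : φ ∈ IsManifold.maximalAtlas (𝓡 3) ∞ M) (hp : p ∈ X.dom φ) {σ : ℝ}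
    (hσ : σ * σ = 1) : (splitMatrix (σ * X.N φ p ^ 2) (X.g φ p))⁻¹ * X.γ φ p
      = splitMatrix (-σ) 1 := by
  have := inv_split_mul hφ hp hσ (-1) (X.g φ p)
  rwa [mul_neg_one, mul_neg_one, Matrix.nonsing_inv_mul _ (isUnit_det_g hφ hp)] at this

theorem inv_split_mul_smul_g (hφ : φ ∈ IsManifold.maximalAtlas (𝓡 3) ∞ M) (hp : p ∈ X.dom φ)
    {σ : ℝ} (hσ : σ * σ = 1) (u v : ℝ) : (splitMatrix (σ * X.N φ p ^ 2) (X.g φ p))⁻¹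
      * splitMatrix (X.N φ p ^ 2 * u) (v • X.g φ p) = splitMatrix (σ * u) (v • 1) := by
  rw [inv_split_mul hφ hp hσ, Matrix.mul_smul, Matrix.nonsing_inv_mul _ (isUnit_det_g hφ hp)]

theorem transpose_split_E (hF : X.IsPerfectFluid mass press)
    (hφ : φ ∈ IsManifold.maximalAtlas (𝓡 3) ∞ M) (hp : p ∈ X.dom φ) :
    (splitMatrix 0 (X.E φ p)).transpose = splitMatrix 0 (X.E φ p) := by
  rw [transpose_splitMatrix, transpose_E hF hφ hp]

theorem normSq_split_W (hF : X.IsPerfectFluid mass press) (hE : X.IsPurelyElectric)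
    (hφ : φ ∈ IsManifold.maximalAtlas (𝓡 3) ∞ M) (hp : p ∈ X.dom φ) {σ : ℝ} (hσ : σ * σ = 1) :
    normSq (splitMatrix (σ * X.N φ p ^ 2) (X.g φ p)) (X.W φ p)
      = 8 * (X.Emix φ p * X.Emix φ p).trace := by
  have hm : (splitMatrix (σ * X.N φ p ^ 2) (X.g φ p)).transpose
      = splitMatrix (σ * X.N φ p ^ 2) (X.g φ p) := by
    rw [transpose_splitMatrix, transpose_g hp]
  have hX := transpose_split_E hF hφ hp
  have hY := transpose_γbar hp
  rw [weyl_eq_kn hF hE hφ hp, normSq_eq_inner4, inner4_kn hm hX hY hX hY,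
    inv_split_mul_E hφ hp hσ, inv_split_mul_γbar hφ hp hσ]
  -- With X = diag(0, E) and Y = diag(σ, 1): tr Y² = 4 and tr XY = 0, so the value is 4(4 - 1 - 1)
  -- tr(E²). Only σ² enters, hence both metrics give the same norm.
  simp only [splitMatrix_mul, trace_splitMatrix, mul_one, trace_Emix hφ hp, Matrix.trace_one,
    Fintype.card_fin, mul_zero, zero_mul, hσ]
  push_cast
  ring

theorem normSq_split_A (hF : X.IsPerfectFluid mass press)
    (hφ : φ ∈ IsManifold.maximalAtlas (𝓡 3) ∞ M) (hp : p ∈ X.dom φ) {σ : ℝ} (hσ : σ * σ = 1) :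
    normSq (splitMatrix (σ * X.N φ p ^ 2) (X.g φ p)) (X.A φ p)
      = 5 / 3 * inCoord φ mass p ^ 2 + 2 * inCoord φ mass p * inCoord φ press p
        + 3 * inCoord φ press p ^ 2 := by
  have hm : (splitMatrix (σ * X.N φ p ^ 2) (X.g φ p)).transpose
      = splitMatrix (σ * X.N φ p ^ 2) (X.g φ p) := by
    rw [transpose_splitMatrix, transpose_g hp]
  have hX := fun u v => transpose_split_g (X := X) hp u v
  have hY := transpose_γ hp
  rw [A_eq_kn hF hφ hp, normSq_smul, normSq_eq_inner4, inner4_kn hm (hX _ _) hY (hX _ _) hY,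
    inv_split_mul_smul_g hφ hp hσ, inv_split_mul_γ hφ hp hσ]
  simp only [splitMatrix_mul, trace_splitMatrix, Matrix.mul_one, Matrix.trace_one,
    Fintype.card_fin, Matrix.mul_smul, Matrix.trace_smul, smul_eq_mul]
  push_cast
  have h2 : σ ^ 2 = 1 := by linear_combination hσ
  ring_nf
  simp only [h2]
  ring

/-- Every trace that occurs contains `E` once, against blocks that are multiples of the identity,
and so contains a factor tr E = 0. -/
theorem inner4_W_A (hF : X.IsPerfectFluid mass press) (hE : X.IsPurelyElectric)
    (hφ : φ ∈ IsManifold.maximalAtlas (𝓡 3) ∞ M) (hp : p ∈ X.dom φ) {σ : ℝ} (hσ : σ * σ = 1) :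
    inner4 (splitMatrix (σ * X.N φ p ^ 2) (X.g φ p)) (X.W φ p) (X.A φ p) = 0 ∧
    inner4 (splitMatrix (σ * X.N φ p ^ 2) (X.g φ p)) (X.A φ p) (X.W φ p) = 0 := by
  have hm : (splitMatrix (σ * X.N φ p ^ 2) (X.g φ p)).transpose
      = splitMatrix (σ * X.N φ p ^ 2) (X.g φ p) := by
    rw [transpose_splitMatrix, transpose_g hp]
  have hX := fun u v => transpose_split_g (X := X) hp u v
  have hY := transpose_γ hp
  have hX' := transpose_split_E hF hφ hp
  have hY' := transpose_γbar hp
  rw [A_eq_kn hF hφ hp, weyl_eq_kn hF hE hφ hp]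
  rw [inner4_smul_left, inner4_smul_right, inner4_kn hm hX' hY' (hX _ _) hY,
    inner4_kn hm (hX _ _) hY hX' hY',
    inv_split_mul_smul_g hφ hp hσ, inv_split_mul_γ hφ hp hσ, inv_split_mul_E hφ hp hσ,
    inv_split_mul_γbar hφ hp hσ]
  simp only [splitMatrix_mul, trace_splitMatrix, Matrix.mul_one, Matrix.one_mul, trace_Emix hφ hp,
    Matrix.smul_mul, Matrix.mul_smul, Matrix.trace_smul, smul_eq_mul, mul_zero, zero_mul]
  simp

theorem normSq_γ_W (hF : X.IsPerfectFluid mass press) (hE : X.IsPurelyElectric)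
    (hφ : φ ∈ IsManifold.maximalAtlas (𝓡 3) ∞ M) (hp : p ∈ X.dom φ) :
    normSq (X.γ φ p) (X.W φ p) = 8 * (X.Emix φ p * X.Emix φ p).trace := by
  rw [γ_eq_split, normSq_split_W hF hE hφ hp (by norm_num)]

theorem normSq_γbar_W (hF : X.IsPerfectFluid mass press) (hE : X.IsPurelyElectric)
    (hφ : φ ∈ IsManifold.maximalAtlas (𝓡 3) ∞ M) (hp : p ∈ X.dom φ) :
    normSq (X.γbar φ p) (X.W φ p) = 8 * (X.Emix φ p * X.Emix φ p).trace := by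
  rw [γbar_eq_split, normSq_split_W hF hE hφ hp (by norm_num)]

theorem normSqA_eq (hF : X.IsPerfectFluid mass press)
    (hφ : φ ∈ IsManifold.maximalAtlas (𝓡 3) ∞ M) (hp : p ∈ X.dom φ) :
    X.normSqA φ p = 5 / 3 * inCoord φ mass p ^ 2 + 2 * inCoord φ mass p * inCoord φ press p
        + 3 * inCoord φ press p ^ 2 := by
  rw [normSqA, γ_eq_split, normSq_split_A hF hφ hp (by norm_num)]

theorem normSq_γbar_R (hF : X.IsPerfectFluid mass press) (hE : X.IsPurelyElectric)
    (hφ : φ ∈ IsManifold.maximalAtlas (𝓡 3) ∞ M) (hp : p ∈ X.dom φ) :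
    normSq (X.γbar φ p) (X.R φ p) = 8 * (X.Emix φ p * X.Emix φ p).trace + X.normSqA φ p := by
  have h := inner4_W_A hF hE hφ hp (σ := 1) (by norm_num)
  rw [R_eq_add, normSq_add, normSq_γbar_W hF hE hφ hp, normSqA_eq hF hφ hp, γbar_eq_split, h.1, h.2,
    normSq_split_A hF hφ hp (by norm_num)]
  ring

/-- Since W is a product with `E` as a factor, W ≠ 0 forces E ≠ 0; positivity is then that of the
Riemannian metric g. -/
theorem trace_Emix_sq_pos (hF : X.IsPerfectFluid mass press) (hE : X.IsPurelyElectric)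
    (hφ : φ ∈ IsManifold.maximalAtlas (𝓡 3) ∞ M) (hp : p ∈ X.dom φ) (hW : X.W φ p ≠ 0) :
    0 < (X.Emix φ p * X.Emix φ p).trace := by
  refine trace_mul_self_pos (posDef_g hφ hp).inv (transpose_E hF hφ hp) fun h => hW ?_
  rw [weyl_eq_kn hF hE hφ hp, h, splitMatrix_zero, kn_zero_left]

/-- The quadratic form is (M + 3P)²/3 + 4M²/3. It is positive definite in (M, P), which also gives
the three lemmas that follow. -/
theorem normSqA_nonneg (hF : X.IsPerfectFluid mass press)
    (hφ : φ ∈ IsManifold.maximalAtlas (𝓡 3) ∞ M) (hp : p ∈ X.dom φ) : 0 ≤ X.normSqA φ p := by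
  rw [normSqA_eq hF hφ hp]
  nlinarith [sq_nonneg (inCoord φ mass p + 3 * inCoord φ press p), sq_nonneg (inCoord φ mass p)]

theorem mass_eq_zero (hF : X.IsPerfectFluid mass press)
    (hφ : φ ∈ IsManifold.maximalAtlas (𝓡 3) ∞ M) (hp : p ∈ X.dom φ) (hA : X.A φ p = 0) :
    inCoord φ mass p = 0 := by
  have h := normSqA_eq hF hφ hp
  rw [normSqA, hA, normSq_zero] at h
  nlinarith [sq_nonneg (inCoord φ mass p + 3 * inCoord φ press p), sq_nonneg (inCoord φ mass p)]

theorem A_eq_zero (hF : X.IsPerfectFluid mass press)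
    (hφ : φ ∈ IsManifold.maximalAtlas (𝓡 3) ∞ M) (hp : p ∈ X.dom φ) (hm : inCoord φ mass p = 0)
    (hP : inCoord φ press p = 0) : X.A φ p = 0 := by
  rw [A_eq_kn hF hφ hp, hm, hP]
  simp [splitMatrix_zero, kn_zero_left]

theorem normSqA_pos (hF : X.IsPerfectFluid mass press)
    (hφ : φ ∈ IsManifold.maximalAtlas (𝓡 3) ∞ M) (hp : p ∈ X.dom φ) (hA : X.A φ p ≠ 0) :
    0 < X.normSqA φ p := by
  refine (normSqA_nonneg hF hφ hp).lt_of_ne fun h => hA ?_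
  rw [normSqA_eq hF hφ hp] at h
  have h1 : inCoord φ mass p = 0 := by
    nlinarith [sq_nonneg (inCoord φ mass p + 3 * inCoord φ press p), sq_nonneg (inCoord φ mass p)]
  refine A_eq_zero hF hφ hp h1 ?_
  rw [h1] at h
  nlinarith

end Norms

/-! ### The components of the curvature and connection matrices -/

section Components

theorem curvMat_zero_apply (hφ : φ ∈ IsManifold.maximalAtlas (𝓡 3) ∞ M) (hp : p ∈ X.dom φ)
    (b c d : Fin 4) :
    curvMat (X.dom φ) (X.γ φ) c d p 0 b = -(X.N φ p ^ 2)⁻¹ * X.R φ p 0 b c d := by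
  rw [curvMat_eq_inv_mul ((isSmoothMetric_γ hφ).isUnit_det hp), inv_γ hφ hp,
    Fin.sum_univ_succ (n := 3)]
  simp [R]

theorem curvMat_succ_apply (hφ : φ ∈ IsManifold.maximalAtlas (𝓡 3) ∞ M) (hp : p ∈ X.dom φ)
    (k : Fin 3) (b c d : Fin 4) : curvMat (X.dom φ) (X.γ φ) c d p k.succ b
      = ∑ l : Fin 3, (X.g φ p)⁻¹ k l * X.R φ p l.succ b c d := by
  rw [curvMat_eq_inv_mul ((isSmoothMetric_γ hφ).isUnit_det hp), inv_γ hφ hp,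
    Fin.sum_univ_succ (n := 3)]
  simp [R]

variable (X) in
/-- The components `R_{TiTj}` in terms of the electric part and the matter content. -/
def tidal (mass press : ℝ → M → ℝ) (φ : OpenPartialHomeomorph M E3) (p : ℝ × E3) :
    Matrix (Fin 3) (Fin 3) ℝ :=
  X.E φ p + ((inCoord φ mass p / 3 + inCoord φ press p) / 2) • X.g φ p

theorem R_eq (hF : X.IsPerfectFluid mass press) (hE : X.IsPurelyElectric)
    (hφ : φ ∈ IsManifold.maximalAtlas (𝓡 3) ∞ M) (hp : p ∈ X.dom φ) (a b c d : Fin 4) :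
    X.R φ p a b c d = kn (splitMatrix 0 (X.E φ p)) (X.γbar φ p) a b c d
      + 1 / 2 * kn (splitMatrix
      (X.N φ p ^ 2 * (2 / 3 * inCoord φ mass p + inCoord φ press p))
        ((inCoord φ mass p / 3) • X.g φ p)) (X.γ φ p) a b c d := by
  rw [R_eq_add, A_eq_kn hF hφ hp, weyl_eq_kn hF hE hφ hp]
  rfl

variable (hF : X.IsPerfectFluid mass press) (hE : X.IsPurelyElectric)
  (hφ : φ ∈ IsManifold.maximalAtlas (𝓡 3) ∞ M) (hp : p ∈ X.dom φ)
include hF hE hφ hp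

theorem curvMat_spatial (i j k l : Fin 3) :
    curvMat (X.dom φ) (X.γ φ) i.succ j.succ p k.succ l.succ
      = X.Emix φ p k i * X.g φ p l j + X.E φ p l j * (1 : Matrix (Fin 3) (Fin 3) ℝ) k i
        - X.Emix φ p k j * X.g φ p l i - X.E φ p l i * (1 : Matrix (Fin 3) (Fin 3) ℝ) k j
        + inCoord φ mass p / 3 * ((1 : Matrix (Fin 3) (Fin 3) ℝ) k i * X.g φ p l j
          - (1 : Matrix (Fin 3) (Fin 3) ℝ) k j * X.g φ p l i) := by
  have hgg : ∀ i j, ∑ k, (X.g φ p)⁻¹ i k * X.g φ p k j = (1 : Matrix (Fin 3) (Fin 3) ℝ) i j := by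
    intro i j
    rw [← Matrix.mul_apply, Matrix.nonsing_inv_mul _ (isUnit_det_g hφ hp)]
  have hee : ∀ i j, ∑ k, (X.g φ p)⁻¹ i k * X.E φ p k j = X.Emix φ p i j := by
    intro i j
    rw [← Matrix.mul_apply, Emix]
  rw [curvMat_succ_apply hφ hp]
  have : ∀ m : Fin 3, (X.g φ p)⁻¹ k m * X.R φ p m.succ l.succ i.succ j.succ
      = ((X.g φ p)⁻¹ k m * X.E φ p m i) * X.g φ p l j
        + X.E φ p l j * ((X.g φ p)⁻¹ k m * X.g φ p m i)
        - ((X.g φ p)⁻¹ k m * X.E φ p m j) * X.g φ p l i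
        - X.E φ p l i * ((X.g φ p)⁻¹ k m * X.g φ p m j)
        + inCoord φ mass p / 3 * ((X.g φ p)⁻¹ k m * X.g φ p m i * X.g φ p l j
          - (X.g φ p)⁻¹ k m * X.g φ p m j * X.g φ p l i) := by
    intro m
    rw [R_eq hF hE hφ hp]
    simp only [kn, γ, γbar, splitMatrix_succ_succ, Matrix.smul_apply, smul_eq_mul]
    ring
  simp only [this, Finset.sum_sub_distrib, Finset.sum_add_distrib, ← Finset.mul_sum,
    ← Finset.sum_mul, hgg, hee]

theorem curvMat_spatial_zero_left (i j l : Fin 3) :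
    curvMat (X.dom φ) (X.γ φ) i.succ j.succ p 0 l.succ = 0 := by
  rw [curvMat_zero_apply hφ hp, R_eq hF hE hφ hp]
  simp [kn, γ, γbar]

theorem curvMat_spatial_zero_right (i j k : Fin 3) :
    curvMat (X.dom φ) (X.γ φ) i.succ j.succ p k.succ 0 = 0 := by
  rw [curvMat_succ_apply hφ hp]
  refine Finset.sum_eq_zero fun m _ => ?_
  rw [R_eq hF hE hφ hp]
  simp [kn, γ, γbar]

/-- Both W and A have no components with exactly one time index. As this holds on the whole domain,
the spatial derivatives of these components vanish too, which closes the evolution equation. -/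
theorem curvMat_mixed_spatial (j k l : Fin 3) :
    curvMat (X.dom φ) (X.γ φ) j.succ 0 p k.succ l.succ = 0 := by
  rw [curvMat_succ_apply hφ hp]
  refine Finset.sum_eq_zero fun m _ => ?_
  rw [R_eq hF hE hφ hp]
  simp [kn, γ, γbar]

theorem curvMat_mixed_zero_left (j l : Fin 3) :
    curvMat (X.dom φ) (X.γ φ) j.succ 0 p 0 l.succ = X.tidal mass press φ p l j := by
  have hN := (N_pos hp).ne'
  rw [curvMat_zero_apply hφ hp, R_eq hF hE hφ hp]
  simp [kn, γ, γbar, tidal]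
  field_simp
  ring

theorem curvMat_mixed_zero_right (j k : Fin 3) :
    curvMat (X.dom φ) (X.γ φ) j.succ 0 p k.succ 0
      = X.N φ p ^ 2 * ((X.g φ p)⁻¹ * X.tidal mass press φ p) k j := by
  rw [curvMat_succ_apply hφ hp, Matrix.mul_apply, Finset.mul_sum]
  refine Finset.sum_congr rfl fun m _ => ?_
  rw [R_eq hF hE hφ hp]
  simp [kn, γ, γbar, tidal]
  ring

end Components

end SplitSpacetime
namespace SplitSpacetime

variable {M : Type*} [TopologicalSpace M] [ChartedSpace E3 M] (X : SplitSpacetime M)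

/-- The mixed components `h_i{}^j` of the second fundamental form. -/
def shape (φ : OpenPartialHomeomorph M E3) (p : ℝ × E3) : Matrix (Fin 3) (Fin 3) ℝ :=
  (X.g φ p)⁻¹ * X.h φ p

/-! ### Time derivatives -/

section TimeDerivative

variable {X} {φ : OpenPartialHomeomorph M E3} {p : ℝ × E3}

/-- Turns partial derivatives on the coordinate domain into one-variable derivatives along a time
line, one-sided at end points. -/
theorem hasDerivWithinAt_time {f : ℝ × E3 → ℝ} (hf : ContDiffOn ℝ ∞ f (X.dom φ))
    (hp : p ∈ X.dom φ) :
    HasDerivWithinAt (fun s => f (s, p.2)) (pd (X.dom φ) 0 f p) X.I p.1 := by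
  have h1 := (hf.differentiableOn (by simp) p hp).hasFDerivWithinAt
  have h2 : HasDerivWithinAt (fun s : ℝ => (s, p.2)) ((1 : ℝ), (0 : E3)) X.I p.1 :=
    (hasDerivWithinAt_id _ _).prodMk (hasDerivWithinAt_const _ _ _)
  exact h1.comp_hasDerivWithinAt (f := fun s : ℝ => (s, p.2)) p.1 h2 fun s hs => ⟨hs, hp.2⟩

theorem DT_of_hasDerivWithinAt {f : ℝ × E3 → ℝ} {f' : ℝ} (hp : p ∈ X.dom φ)
    (hf : HasDerivWithinAt (fun s => f (s, p.2)) f' X.I p.1) :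
    X.DT φ f p = (X.N φ p)⁻¹ * f' := by
  rw [DT, hf.derivWithin (X.uniqueDiffOn_I _ hp.1)]

theorem hasDerivWithinAt_trace {F : ℝ × E3 → Matrix (Fin 3) (Fin 3) ℝ}
    (hF : SmoothMat (X.dom φ) F) (hp : p ∈ X.dom φ) :
    HasDerivWithinAt (fun s => (F (s, p.2)).trace) (pdMat (X.dom φ) 0 F p).trace X.I p.1 :=
  HasDerivWithinAt.fun_sum fun i _ => hasDerivWithinAt_time (hF i i) hp

theorem pdMat_g (hφ : φ ∈ IsManifold.maximalAtlas (𝓡 3) ∞ M) (hp : p ∈ X.dom φ) :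
    pdMat (X.dom φ) 0 (X.g φ) p = (-2 * X.N φ p) • X.h φ p := by
  have hN := (N_pos hp).ne'
  ext i j
  simp only [pdMat, Matrix.of_apply, Matrix.smul_apply, h, smul_eq_mul]
  rw [DT_of_hasDerivWithinAt hp (hasDerivWithinAt_time (smoothMat_g hφ i j) hp)]
  field_simp

theorem pd_g (hφ : φ ∈ IsManifold.maximalAtlas (𝓡 3) ∞ M) (hp : p ∈ X.dom φ) (i j : Fin 3) :
    pd (X.dom φ) 0 (fun q => X.g φ q i j) p = -2 * X.N φ p * X.h φ p i j :=
  congrFun (congrFun (pdMat_g hφ hp) i) j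

theorem transpose_h (hp : p ∈ X.dom φ) : (X.h φ p).transpose = X.h φ p := by
  ext i j
  simp only [Matrix.transpose_apply, h, Matrix.of_apply, DT]
  congr 2
  exact derivWithin_congr (fun s hs => X.metric_symm s hs _ _ _) (X.metric_symm _ hp.1 _ _ _)

theorem H_eq_trace (hp : p ∈ X.dom φ) : X.H φ p = (X.shape φ p).trace := by
  rw [shape]
  conv_rhs => rw [← transpose_h hp]
  simp [H, Matrix.trace, Matrix.mul_apply]

variable [IsManifold (𝓡 3) ∞ M]

theorem g_mul_shape (hφ : φ ∈ IsManifold.maximalAtlas (𝓡 3) ∞ M) (hp : p ∈ X.dom φ) :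
    X.g φ p * X.shape φ p = X.h φ p :=
  Matrix.mul_nonsing_inv_cancel_left _ _ (isUnit_det_g hφ hp)

theorem g_mul_Emix (hφ : φ ∈ IsManifold.maximalAtlas (𝓡 3) ∞ M) (hp : p ∈ X.dom φ) :
    X.g φ p * X.Emix φ p = X.E φ p :=
  Matrix.mul_nonsing_inv_cancel_left _ _ (isUnit_det_g hφ hp)

theorem transpose_shape_mul_g (hφ : φ ∈ IsManifold.maximalAtlas (𝓡 3) ∞ M) (hp : p ∈ X.dom φ) :
    (X.shape φ p).transpose * X.g φ p = X.g φ p * X.shape φ p := by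
  have := congrArg Matrix.transpose (g_mul_shape hφ hp)
  rwa [Matrix.transpose_mul, transpose_g hp, transpose_h hp, ← g_mul_shape hφ hp] at this

theorem hasDerivWithinAt_sqrtDet (hφ : φ ∈ IsManifold.maximalAtlas (𝓡 3) ∞ M)
    (hp : p ∈ X.dom φ) : HasDerivWithinAt (fun s => X.sqrtDet φ (s, p.2))
      (-(X.N φ p * X.H φ p * X.sqrtDet φ p)) X.I p.1 := by
  have hg : ∀ i j, HasDerivWithinAt (fun s => X.g φ (s, p.2) i j)
      (pdMat (X.dom φ) 0 (X.g φ) p i j) X.I p.1 :=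
    fun i j => hasDerivWithinAt_time (smoothMat_g (X := X) hφ i j) hp
  have hpos := (posDef_g hφ hp).det_pos
  have hdet : HasDerivWithinAt (fun s => (X.g φ (s, p.2)).det)
      ((X.g φ p).adjugate * pdMat (X.dom φ) 0 (X.g φ) p).trace X.I p.1 := by
    simp only [Matrix.det_fin_three]
    have := (((((((hg 0 0).mul (hg 1 1)).mul (hg 2 2)).sub
      (((hg 0 0).mul (hg 1 2)).mul (hg 2 1))).sub (((hg 0 1).mul (hg 1 0)).mul (hg 2 2))).add
      (((hg 0 1).mul (hg 1 2)).mul (hg 2 0))).add (((hg 0 2).mul (hg 1 0)).mul (hg 2 1))).sub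
      (((hg 0 2).mul (hg 1 1)).mul (hg 2 0))
    refine this.congr_deriv ?_
    simp only [Matrix.trace_fin_three, Matrix.mul_apply, Fin.sum_univ_three,
      Matrix.adjugate_fin_three, Pi.mul_apply, Prod.mk.eta]
    simp
    ring
  -- Jacobi's formula: the adjugate is det(g) g⁻¹, so the derivative of det g is det(g) tr(g⁻¹∂ₜg) =
  -- -2NH det(g).
  have hadj : (X.g φ p).adjugate = (X.g φ p).det • (X.g φ p)⁻¹ := by
    rw [Matrix.inv_def, smul_smul, Ring.mul_inverse_cancel _ (isUnit_det_g hφ hp), one_smul]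
  rw [hadj, pdMat_g hφ hp, Matrix.smul_mul, Matrix.mul_smul, Matrix.trace_smul, Matrix.trace_smul,
    ← shape, ← H_eq_trace hp] at hdet
  refine (hdet.sqrt hpos.ne').congr_deriv ?_
  have hs : X.sqrtDet φ p * X.sqrtDet φ p = (X.g φ p).det := Real.mul_self_sqrt hpos.le
  have hs0 : X.sqrtDet φ p ≠ 0 := (Real.sqrt_pos.2 hpos).ne'
  change _ / (2 * X.sqrtDet φ p) = _
  rw [smul_eq_mul, smul_eq_mul, ← hs]
  field_simp

end TimeDerivative

/-! ### The contractions of the electric part with the second fundamental form -/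

section Contractions

variable {X} {mass press : ℝ → M → ℝ} {φ : OpenPartialHomeomorph M E3} {p : ℝ × E3}
  [IsManifold (𝓡 3) ∞ M]

theorem inv_mul_hring (hφ : φ ∈ IsManifold.maximalAtlas (𝓡 3) ∞ M) (hp : p ∈ X.dom φ) :
    (X.g φ p)⁻¹ * X.hring φ p = X.shape φ p - (X.H φ p / 3) • 1 := by
  rw [hring, Matrix.mul_sub, Matrix.mul_smul, Matrix.nonsing_inv_mul _ (isUnit_det_g hφ hp), shape]

/-- The trace part of h contributes a multiple of tr E = 0, so h̊ may be replaced by h. -/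
theorem hringE_eq (hF : X.IsPerfectFluid mass press)
    (hφ : φ ∈ IsManifold.maximalAtlas (𝓡 3) ∞ M) (hp : p ∈ X.dom φ) :
    X.hringE φ p = (X.shape φ p * X.Emix φ p).trace := by
  have hEs : ∀ i j, X.E φ p i j = X.E φ p j i :=
    fun i j => congrFun (congrFun (transpose_E hF hφ hp) j) i
  have hgi : ∀ i j, (X.g φ p)⁻¹ i j = (X.g φ p)⁻¹ j i :=
    fun i j => congrFun (congrFun (transpose_inv_g hp) j) i
  have h1 : X.hringE φ p = (((X.g φ p)⁻¹ * X.hring φ p) * X.Emix φ p).trace := by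
    have e : ∀ i i' j j', (X.g φ p)⁻¹ i i' * (X.g φ p)⁻¹ j j' * (X.hring φ p i j * X.E φ p i' j')
        = (X.g φ p)⁻¹ i' i * (X.hring φ p i j * ((X.g φ p)⁻¹ j j' * X.E φ p j' i')) := by
      intro i i' j j'
      rw [hgi i i', hEs i' j']
      ring
    simp only [hringE, e, ← Finset.mul_sum, ← Matrix.mul_apply]
    rw [Finset.sum_comm, Matrix.mul_assoc]
    simp only [← Matrix.mul_apply]
    rfl
  rw [h1, inv_mul_hring hφ hp, Matrix.sub_mul, Matrix.trace_sub, Matrix.smul_mul, Matrix.one_mul,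
    Matrix.trace_smul, trace_Emix hφ hp, smul_zero, sub_zero]

theorem hringEE_eq (hF : X.IsPerfectFluid mass press)
    (hφ : φ ∈ IsManifold.maximalAtlas (𝓡 3) ∞ M) (hp : p ∈ X.dom φ) :
    X.hringEE φ p = (X.Emix φ p * X.Emix φ p * X.shape φ p).trace
      - X.H φ p / 3 * (X.Emix φ p * X.Emix φ p).trace := by
  have hEs : ∀ i j, X.E φ p i j = X.E φ p j i :=
    fun i j => congrFun (congrFun (transpose_E hF hφ hp) j) i
  have hgi : ∀ i j, (X.g φ p)⁻¹ i j = (X.g φ p)⁻¹ j i :=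
    fun i j => congrFun (congrFun (transpose_inv_g hp) j) i
  have h1 : X.hringEE φ p
      = ((X.g φ p)⁻¹ * (X.E φ p * (X.g φ p)⁻¹ * (X.hring φ p * X.Emix φ p))).trace := by
    have e : ∀ i i' j j' l l', (X.g φ p)⁻¹ i i' * (X.g φ p)⁻¹ j j' * (X.g φ p)⁻¹ l l' *
        (X.hring φ p j l * X.E φ p i j' * X.E φ p i' l')
        = (X.g φ p)⁻¹ i' i * ((X.E φ p i j' * (X.g φ p)⁻¹ j' j) *
          (X.hring φ p j l * ((X.g φ p)⁻¹ l l' * X.E φ p l' i'))) := by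
      intro i i' j j' l l'
      rw [hgi i i', hEs i' l', hgi j j']
      ring
    simp only [hringEE, e, ← Finset.mul_sum, ← Finset.sum_mul, ← Matrix.mul_apply]
    rw [Finset.sum_comm]
    simp only [← Matrix.mul_apply]
    rfl
  have h2 : (X.g φ p)⁻¹ * (X.E φ p * (X.g φ p)⁻¹ * (X.hring φ p * X.Emix φ p))
      = X.Emix φ p * ((X.g φ p)⁻¹ * X.hring φ p) * X.Emix φ p := by
    simp only [Emix, Matrix.mul_assoc]
  rw [h1, h2, inv_mul_hring hφ hp, Matrix.trace_mul_comm, Matrix.mul_sub, Matrix.mul_sub,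
    Matrix.trace_sub]
  simp only [Matrix.mul_smul, Matrix.mul_one, Matrix.trace_smul, smul_eq_mul, Matrix.mul_assoc]

end Contractions

/-! ### The evolution equations -/

section Evolution

variable {X} {mass press : ℝ → M → ℝ} {φ : OpenPartialHomeomorph M E3} {p : ℝ × E3}
  [IsManifold (𝓡 3) ∞ M]

/-- The shift components of the metric are identically zero, so only ½ g⁻¹∂ₜg remains. -/
theorem connMat_zero_succ_succ (hφ : φ ∈ IsManifold.maximalAtlas (𝓡 3) ∞ M) (hp : p ∈ X.dom φ)
    (k m : Fin 3) :
    connMat (X.dom φ) (X.γ φ) 0 p k.succ m.succ = -(X.N φ p * X.shape φ p k m) := by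
  simp only [connMat, Matrix.of_apply, christoffel]
  rw [inv_γ hφ hp]
  simp only [Fin.sum_univ_succ (n := 3), splitMatrix_succ_zero, splitMatrix_succ_succ, γ,
    splitMatrix_zero_succ, pd_const, zero_mul, zero_add, add_zero, sub_zero, pd_g hφ hp, shape,
    Matrix.mul_apply, Finset.mul_sum, ← Finset.sum_neg_distrib]
  exact Finset.sum_congr rfl fun l _ => by ring

theorem connMat_succ_succ_zero (hφ : φ ∈ IsManifold.maximalAtlas (𝓡 3) ∞ M) (hp : p ∈ X.dom φ)
    (i k : Fin 3) :
    connMat (X.dom φ) (X.γ φ) i.succ p k.succ 0 = -(X.N φ p * X.shape φ p k i) := by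
  rw [← connMat_zero_succ_succ hφ hp]
  exact (isSmoothMetric_γ hφ).christoffel_symm _ _ _ hp

theorem connMat_succ_zero_succ (hφ : φ ∈ IsManifold.maximalAtlas (𝓡 3) ∞ M) (hp : p ∈ X.dom φ)
    (i l : Fin 3) :
    connMat (X.dom φ) (X.γ φ) i.succ p 0 l.succ = -(X.h φ p i l / X.N φ p) := by
  have hN := (N_pos hp).ne'
  simp only [connMat, Matrix.of_apply, christoffel]
  rw [inv_γ hφ hp]
  simp only [Fin.sum_univ_succ (n := 3), splitMatrix_succ_succ, γ, splitMatrix_zero_succ,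
    splitMatrix_zero_zero, pd_const, zero_mul, add_zero, pd_g hφ hp, Finset.sum_const_zero]
  field_simp
  ring

/-- Second Bianchi identity in the directions t, i, j. The derivatives of the lapse sit in Γ^t_{tl},
Γ^k_{tt} and Γ^t_{tt}, and the spatial connection in Γ^k_{ij}; each of these either does not occur
or multiplies a vanishing curvature component, so the result involves only h, the tidal tensor and
R^k_{lij}. -/
theorem pd_curvMat_spatial (hF : X.IsPerfectFluid mass press) (hE : X.IsPurelyElectric)
    (hφ : φ ∈ IsManifold.maximalAtlas (𝓡 3) ∞ M) (hp : p ∈ X.dom φ) (i j k l : Fin 3) :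
    pd (X.dom φ) 0 (fun q => curvMat (X.dom φ) (X.γ φ) i.succ j.succ q k.succ l.succ) p
      = X.N φ p * (∑ m, X.shape φ p k m *
            curvMat (X.dom φ) (X.γ φ) i.succ j.succ p m.succ l.succ
          - ∑ m, curvMat (X.dom φ) (X.γ φ) i.succ j.succ p k.succ m.succ * X.shape φ p m l
          + X.shape φ p k i * X.tidal mass press φ p l j
          - ((X.g φ p)⁻¹ * X.tidal mass press φ p) k j * X.h φ p i l
          - X.shape φ p k j * X.tidal mass press φ p l i
          + ((X.g φ p)⁻¹ * X.tidal mass press φ p) k i * X.h φ p j l) := by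
  have hN := (N_pos hp).ne'
  have hanti : ∀ q, curvMat (X.dom φ) (X.γ φ) 0 i.succ q
      = -curvMat (X.dom φ) (X.γ φ) i.succ 0 q := by
    intro q
    ext a b
    exact riemannUp_antisymm _ _ _ _ _
  have h := congrFun (congrFun ((isSmoothMetric_γ (X := X) hφ).bianchi_second 0 i.succ j.succ hp)
    k.succ) l.succ
  -- The differentiated components are zero throughout the domain, not only at `p`.
  have z1 : pdMat (X.dom φ) i.succ (curvMat (X.dom φ) (X.γ φ) j.succ 0) p k.succ l.succ = 0 :=
    (pd_congr (fun q hq => curvMat_mixed_spatial hF hE hφ hq j k l) _ hp).trans (pd_const _ _ _)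
  have z2 : pdMat (X.dom φ) j.succ (curvMat (X.dom φ) (X.γ φ) 0 i.succ) p k.succ l.succ = 0 := by
    refine (pd_congr (f' := fun _ => 0) (fun q hq => ?_) _ hp).trans (pd_const _ _ _)
    change curvMat (X.dom φ) (X.γ φ) 0 i.succ q k.succ l.succ = 0
    rw [hanti, Matrix.neg_apply, curvMat_mixed_spatial hF hE hφ hq, neg_zero]
  rw [hanti] at h
  simp only [Matrix.add_apply, Matrix.sub_apply, z1, z2, Matrix.mul_neg, Matrix.neg_mul,
    Matrix.neg_apply, Matrix.zero_apply] at h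
  simp only [Matrix.mul_apply (m := Fin 4), Fin.sum_univ_succ (n := 3),
    curvMat_spatial_zero_left hF hE hφ hp, curvMat_spatial_zero_right hF hE hφ hp,
    curvMat_mixed_spatial hF hE hφ hp, curvMat_mixed_zero_left hF hE hφ hp,
    curvMat_mixed_zero_right hF hE hφ hp, connMat_zero_succ_succ hφ hp,
    connMat_succ_succ_zero hφ hp, connMat_succ_zero_succ hφ hp, mul_zero, zero_mul,
    Finset.sum_const_zero, zero_add, add_zero, neg_mul, mul_neg, Finset.sum_neg_distrib,
    sub_neg_eq_add] at h
  simp only [mul_assoc (X.N φ p), mul_left_comm _ (X.N φ p) (X.shape φ p _ _),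
    ← Finset.mul_sum] at h
  change pd (X.dom φ) 0 (fun q => curvMat (X.dom φ) (X.γ φ) i.succ j.succ q k.succ l.succ) p
    + _ + _ + _ = 0 at h
  field_simp at h ⊢
  linear_combination h

end Evolution

end SplitSpacetime
-- Evolution of the spatial Ricci contraction, the mass density and tr(E²)
namespace SplitSpacetime

variable {M : Type*} [TopologicalSpace M] [ChartedSpace E3 M] (X : SplitSpacetime M)

/-- The contraction `R^k_{lkj}` of the curvature tensor over the spatial indices. -/
def spatialRicci (φ : OpenPartialHomeomorph M E3) (p : ℝ × E3) : Matrix (Fin 3) (Fin 3) ℝ :=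
  Matrix.of fun l j => ∑ k : Fin 3, curvMat (X.dom φ) (X.γ φ) k.succ j.succ p k.succ l.succ

/-- The mixed components of `spatialRicci`. -/
def spatialRicciMix (φ : OpenPartialHomeomorph M E3) (p : ℝ × E3) : Matrix (Fin 3) (Fin 3) ℝ :=
  (X.g φ p)⁻¹ * X.spatialRicci φ p

variable {X} {mass press : ℝ → M → ℝ} {φ : OpenPartialHomeomorph M E3} {p : ℝ × E3}
  [IsManifold (𝓡 3) ∞ M]

theorem smoothMat_spatialRicci (hφ : φ ∈ IsManifold.maximalAtlas (𝓡 3) ∞ M) :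
    SmoothMat (X.dom φ) (X.spatialRicci φ) := fun l j => by
  simp only [spatialRicci, Matrix.of_apply]
  exact ContDiffOn.sum fun k _ => (isSmoothMetric_γ (X := X) hφ).smoothMat_curvMat _ _ _ _

/-- Smoothness comes from the metric alone. Mass density and electric part are later recovered as
trace and trace-free part of this matrix, which makes them differentiable in t. -/
theorem smoothMat_spatialRicciMix (hφ : φ ∈ IsManifold.maximalAtlas (𝓡 3) ∞ M) :
    SmoothMat (X.dom φ) (X.spatialRicciMix φ) :=
  ((smoothMat_g hφ).inv fun _ hq => (posDef_g hφ hq).det_pos.ne').mul (smoothMat_spatialRicci hφ)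

theorem spatialRicci_eq (hF : X.IsPerfectFluid mass press) (hE : X.IsPurelyElectric)
    (hφ : φ ∈ IsManifold.maximalAtlas (𝓡 3) ∞ M) (hp : p ∈ X.dom φ) :
    X.spatialRicci φ p = X.E φ p + (2 * inCoord φ mass p / 3) • X.g φ p := by
  have htr : X.Emix φ p 0 0 + X.Emix φ p 1 1 + X.Emix φ p 2 2 = 0 := by
    rw [← Matrix.trace_fin_three, trace_Emix hφ hp]
  ext l j
  have h1 : ∑ k, X.Emix φ p k j * X.g φ p l k = X.E φ p l j := by
    rw [← g_mul_Emix hφ hp, Matrix.mul_apply]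
    exact Finset.sum_congr rfl fun k _ => mul_comm _ _
  have hone : ∀ Y : Matrix (Fin 3) (Fin 3) ℝ,
      ∑ k, (1 : Matrix (Fin 3) (Fin 3) ℝ) k j * Y l k = Y l j := by
    intro Y
    simp [Matrix.one_apply]
  simp only [spatialRicci, Matrix.of_apply, curvMat_spatial hF hE hφ hp, Matrix.one_apply_eq,
    Finset.sum_add_distrib, Finset.sum_sub_distrib, ← Finset.mul_sum, ← Finset.sum_mul, h1,
    mul_comm (X.E φ p l _), hone, Matrix.add_apply, Matrix.smul_apply, smul_eq_mul]
  simp only [Fin.sum_univ_three, htr]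
  ring

theorem spatialRicciMix_eq (hF : X.IsPerfectFluid mass press) (hE : X.IsPurelyElectric)
    (hφ : φ ∈ IsManifold.maximalAtlas (𝓡 3) ∞ M) (hp : p ∈ X.dom φ) :
    X.spatialRicciMix φ p = X.Emix φ p + (2 * inCoord φ mass p / 3) • 1 := by
  rw [spatialRicciMix, spatialRicci_eq hF hE hφ hp, Matrix.mul_add, Matrix.mul_smul,
    Matrix.nonsing_inv_mul _ (isUnit_det_g hφ hp), Emix]

/-- The evolution of R^k_{lij} contracted over k = i; the first group of terms is the shape operator
contracted with the explicit spatial curvature. -/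
theorem pdMat_spatialRicci (hF : X.IsPerfectFluid mass press) (hE : X.IsPurelyElectric)
    (hφ : φ ∈ IsManifold.maximalAtlas (𝓡 3) ∞ M) (hp : p ∈ X.dom φ) :
    pdMat (X.dom φ) 0 (X.spatialRicci φ) p
      = X.N φ p • (((X.shape φ p * X.Emix φ p).trace • X.g φ p
          + (X.shape φ p).trace • X.E φ p - X.g φ p * (X.shape φ p * X.Emix φ p)
          - X.E φ p * X.shape φ p
          + (inCoord φ mass p / 3) • ((X.shape φ p).trace • X.g φ p - X.g φ p * X.shape φ p))
        - (X.shape φ p).transpose * X.spatialRicci φ p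
        + (X.shape φ p).trace • X.tidal mass press φ p
        - X.h φ p * ((X.g φ p)⁻¹ * X.tidal mass press φ p)
        - X.tidal mass press φ p * X.shape φ p
        + ((X.g φ p)⁻¹ * X.tidal mass press φ p).trace • X.h φ p) := by
  have hh : ∀ i j, X.h φ p i j = X.h φ p j i := fun i j => congrFun (congrFun (transpose_h hp) j) i
  ext l j
  have hsum : pdMat (X.dom φ) 0 (X.spatialRicci φ) p l j = ∑ k : Fin 3, pd (X.dom φ) 0
      (fun q => curvMat (X.dom φ) (X.γ φ) k.succ j.succ q k.succ l.succ) p := by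
    simp only [pdMat, spatialRicci, Matrix.of_apply]
    have hs : ∀ k : Fin 3, ContDiffOn ℝ ∞
        (fun q => curvMat (X.dom φ) (X.γ φ) k.succ j.succ q k.succ l.succ) (X.dom φ) := fun k =>
      (isSmoothMetric_γ hφ).smoothMat_curvMat k.succ j.succ k.succ l.succ
    exact pd_sum Finset.univ (X.uniqueDiffOn_dom φ) hs 0 hp
  have hQ : ∑ k : Fin 3, ∑ m : Fin 3, curvMat (X.dom φ) (X.γ φ) k.succ j.succ p k.succ m.succ
      * X.shape φ p m l = ((X.shape φ p).transpose * X.spatialRicci φ p) l j := by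
    rw [Finset.sum_comm]
    simp only [← Finset.sum_mul, Matrix.mul_apply, Matrix.transpose_apply, spatialRicci,
      Matrix.of_apply, mul_comm (X.shape φ p _ l)]
  have hR : ∑ k : Fin 3, ∑ m : Fin 3, X.shape φ p k m
      * curvMat (X.dom φ) (X.γ φ) k.succ j.succ p m.succ l.succ
      = ((X.shape φ p * X.Emix φ p).trace • X.g φ p
          + (X.shape φ p).trace • X.E φ p - X.g φ p * (X.shape φ p * X.Emix φ p)
          - X.E φ p * X.shape φ p
          + (inCoord φ mass p / 3) •
            ((X.shape φ p).trace • X.g φ p - X.g φ p * X.shape φ p)) l j := by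
    simp only [curvMat_spatial hF hE hφ hp, Matrix.one_apply, Matrix.add_apply, Matrix.sub_apply,
      Matrix.smul_apply, smul_eq_mul, Matrix.mul_apply, Matrix.trace, Matrix.diag_apply]
    fin_cases j <;> simp [Fin.sum_univ_three] <;> ring
  rw [hsum]
  simp only [pd_curvMat_spatial hF hE hφ hp, ← Finset.mul_sum, Finset.sum_add_distrib,
    Finset.sum_sub_distrib]
  rw [hQ, hR]
  simp only [Matrix.smul_apply, Matrix.add_apply, Matrix.sub_apply, smul_eq_mul]
  congr 1
  have s1 : ∑ k, X.shape φ p k k * X.tidal mass press φ p l j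
      = (X.shape φ p).trace * X.tidal mass press φ p l j := by
    rw [← Finset.sum_mul]
    rfl
  have s2 : ∑ k, ((X.g φ p)⁻¹ * X.tidal mass press φ p) k j * X.h φ p k l
      = (X.h φ p * ((X.g φ p)⁻¹ * X.tidal mass press φ p)) l j := by
    rw [Matrix.mul_apply]
    exact Finset.sum_congr rfl fun k _ => by rw [hh k l, mul_comm]
  have s3 : ∑ k, X.shape φ p k j * X.tidal mass press φ p l k
      = (X.tidal mass press φ p * X.shape φ p) l j := by
    rw [Matrix.mul_apply]
    exact Finset.sum_congr rfl fun k _ => mul_comm _ _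
  have s4 : ∑ k, ((X.g φ p)⁻¹ * X.tidal mass press φ p) k k * X.h φ p j l
      = ((X.g φ p)⁻¹ * X.tidal mass press φ p).trace * X.h φ p l j := by
    rw [← Finset.sum_mul, hh j l]
    rfl
  rw [s1, s2, s3, s4]

/-- The evolution equation for the electric part of the Weyl tensor and the mass density. -/
theorem pdMat_spatialRicciMix (hF : X.IsPerfectFluid mass press) (hE : X.IsPurelyElectric)
    (hφ : φ ∈ IsManifold.maximalAtlas (𝓡 3) ∞ M) (hp : p ∈ X.dom φ) :
    pdMat (X.dom φ) 0 (X.spatialRicciMix φ) p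
      = X.N φ p • (((X.shape φ p * X.Emix φ p).trace
            + (inCoord φ mass p + inCoord φ press p) / 2 * X.H φ p) • 1
          + (2 * X.H φ p) • X.Emix φ p - X.shape φ p * X.Emix φ p
          - (2 : ℝ) • (X.Emix φ p * X.shape φ p)
          + ((inCoord φ mass p + inCoord φ press p) / 2) • X.shape φ p) := by
  have hu := isUnit_det_g (X := X) hφ hp
  have hQ : ∀ q ∈ X.dom φ, X.spatialRicci φ q = X.g φ q * X.spatialRicciMix φ q := fun q hq =>
    (Matrix.mul_nonsing_inv_cancel_left _ _ (isUnit_det_g hφ hq)).symm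
  -- The mixed form Q is differentiated through gQ: the product rule gives g ∂ₜQ = ∂ₜ(gQ) + 2N h Q,
  -- and g is cancelled at the end.
  have hd := pdMat_congr hQ 0 hp
  rw [pdMat_mul (X.uniqueDiffOn_dom φ) (smoothMat_g hφ) (smoothMat_spatialRicciMix hφ) 0 hp,
    pdMat_spatialRicci hF hE hφ hp, pdMat_g hφ hp, hQ p hp, spatialRicciMix_eq hF hE hφ hp] at hd
  set f := (inCoord φ mass p / 3 + inCoord φ press p) / 2 with hf
  have hT : X.tidal mass press φ p = X.g φ p * (X.Emix φ p + f • 1) := by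
    rw [tidal, Matrix.mul_add, g_mul_Emix hφ hp, Matrix.mul_smul, Matrix.mul_one]
  have hT' : (X.g φ p)⁻¹ * X.tidal mass press φ p = X.Emix φ p + f • 1 := by
    rw [hT, Matrix.nonsing_inv_mul_cancel_left _ _ hu]
  rw [hT', hT, ← g_mul_Emix hφ hp, ← g_mul_shape hφ hp, ← Matrix.mul_assoc (X.shape φ p).transpose,
    transpose_shape_mul_g hφ hp, ← H_eq_trace hp, Matrix.trace_add, trace_Emix hφ hp,
    Matrix.trace_smul, Matrix.trace_one] at hd
  have hd' := congrArg (fun Y => (X.g φ p)⁻¹ * Y) (eq_sub_of_add_eq' hd.symm)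
  simp only [Matrix.nonsing_inv_mul_cancel_left _ _ hu] at hd'
  rw [hd', hf]
  simp only [Matrix.mul_add, Matrix.mul_sub, Matrix.mul_smul, Matrix.smul_mul, Matrix.add_mul,
    Matrix.mul_assoc, Matrix.nonsing_inv_mul_cancel_left _ _ hu, Matrix.nonsing_inv_mul _ hu,
    Matrix.mul_one, Fintype.card_fin]
  push_cast
  module

theorem mass_eq_trace (hF : X.IsPerfectFluid mass press) (hE : X.IsPurelyElectric)
    (hφ : φ ∈ IsManifold.maximalAtlas (𝓡 3) ∞ M) (hp : p ∈ X.dom φ) :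
    inCoord φ mass p = (X.spatialRicciMix φ p).trace / 2 := by
  rw [spatialRicciMix_eq hF hE hφ hp, Matrix.trace_add, trace_Emix hφ hp, Matrix.trace_smul,
    Matrix.trace_one, smul_eq_mul, Fintype.card_fin]
  push_cast
  ring

theorem trace_Emix_sq_eq (hF : X.IsPerfectFluid mass press) (hE : X.IsPurelyElectric)
    (hφ : φ ∈ IsManifold.maximalAtlas (𝓡 3) ∞ M) (hp : p ∈ X.dom φ) :
    (X.Emix φ p * X.Emix φ p).trace
      = (X.spatialRicciMix φ p * X.spatialRicciMix φ p).trace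
        - (X.spatialRicciMix φ p).trace ^ 2 / 3 := by
  rw [spatialRicciMix_eq hF hE hφ hp]
  simp only [Matrix.mul_add, Matrix.add_mul, Matrix.trace_add, Matrix.smul_mul, Matrix.mul_smul,
    Matrix.trace_smul, Matrix.one_mul, Matrix.mul_one, trace_Emix hφ hp, Matrix.trace_one,
    smul_eq_mul, Fintype.card_fin]
  push_cast
  ring

/-- Conservation of energy. -/
theorem hasDerivWithinAt_mass (hF : X.IsPerfectFluid mass press) (hE : X.IsPurelyElectric)
    (hφ : φ ∈ IsManifold.maximalAtlas (𝓡 3) ∞ M) (hp : p ∈ X.dom φ) :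
    HasDerivWithinAt (fun s => inCoord φ mass (s, p.2))
      (X.N φ p * ((inCoord φ mass p + inCoord φ press p) * X.H φ p)) X.I p.1 := by
  have h := (hasDerivWithinAt_trace (smoothMat_spatialRicciMix (X := X) hφ) hp).div_const 2
  refine (h.congr (fun s hs => mass_eq_trace hF hE hφ (p := (s, p.2)) ⟨hs, hp.2⟩)
    (mass_eq_trace hF hE hφ hp)).congr_deriv ?_
  -- In the trace the terms tr(hE) cancel as 3 - 1 - 2, and the matter terms add up to (3/2 + 1/2)(M
  -- + P)H, halved by the factor in `mass_eq_trace`.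
  rw [pdMat_spatialRicciMix hF hE hφ hp]
  simp only [Matrix.trace_add, Matrix.trace_sub, Matrix.trace_smul, smul_eq_mul, trace_Emix hφ hp,
    Matrix.trace_one, Fintype.card_fin, ← H_eq_trace hp, Matrix.trace_mul_comm (X.Emix φ p)]
  push_cast
  ring

/-- Differentiates tr(Q²) - (tr Q)²/3, the squared norm of the trace-free part of Q. The evolution
gives 4H tr(E²) - 6 tr(E²h); passing from h to h̊ turns the 4 into 2. -/
theorem hasDerivWithinAt_trace_Emix_sq (hF : X.IsPerfectFluid mass press)
    (hE : X.IsPurelyElectric) (hφ : φ ∈ IsManifold.maximalAtlas (𝓡 3) ∞ M) (hp : p ∈ X.dom φ) :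
    HasDerivWithinAt (fun s => (X.Emix φ (s, p.2) * X.Emix φ (s, p.2)).trace)
      (X.N φ p * (2 * X.H φ p * (X.Emix φ p * X.Emix φ p).trace - 6 * X.hringEE φ p
        + (inCoord φ mass p + inCoord φ press p) * X.hringE φ p)) X.I p.1 := by
  have hq := smoothMat_spatialRicciMix (X := X) hφ
  have h := (hasDerivWithinAt_trace (hq.mul hq) hp).sub
    (((hasDerivWithinAt_trace hq hp).pow 2).div_const 3)
  refine (h.congr (fun s hs => trace_Emix_sq_eq hF hE hφ (p := (s, p.2)) ⟨hs, hp.2⟩)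
    (trace_Emix_sq_eq hF hE hφ hp)).congr_deriv ?_
  rw [pdMat_mul (X.uniqueDiffOn_dom φ) hq hq 0 hp, Matrix.trace_add,
    Matrix.trace_mul_comm (X.spatialRicciMix φ p), hringE_eq hF hφ hp, hringEE_eq hF hφ hp]
  change _ - _ * (X.spatialRicciMix φ p).trace ^ _ * _ / _ = _
  rw [pdMat_spatialRicciMix hF hE hφ hp, spatialRicciMix_eq hF hE hφ hp]
  have c1 : (X.shape φ p * X.Emix φ p * X.Emix φ p).trace
      = (X.Emix φ p * X.Emix φ p * X.shape φ p).trace := by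
    rw [Matrix.mul_assoc, Matrix.trace_mul_comm]
  have c2 : (X.Emix φ p * X.shape φ p * X.Emix φ p).trace
      = (X.Emix φ p * X.Emix φ p * X.shape φ p).trace := by
    rw [Matrix.trace_mul_comm, Matrix.mul_assoc]
  simp only [Matrix.mul_add, Matrix.add_mul, Matrix.sub_mul, Matrix.trace_add, Matrix.trace_sub,
    Matrix.smul_mul, Matrix.mul_smul, Matrix.trace_smul, Matrix.one_mul, Matrix.mul_one,
    trace_Emix hφ hp, Matrix.trace_one, smul_eq_mul, Fintype.card_fin, ← H_eq_trace hp, c1, c2,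
    Matrix.trace_mul_comm (X.Emix φ p) (X.shape φ p)]
  push_cast
  ring

end SplitSpacetime

/-- A solution of a linear homogeneous equation on an interval vanishes if it vanishes somewhere. -/
theorem eq_zero_of_linear_ode {I : Set ℝ} (hI : I.OrdConnected) {c f : ℝ → ℝ}
    (hc : ContinuousOn c I) (hf : ∀ t ∈ I, HasDerivWithinAt f (c t * f t) I t) {t₀ : ℝ}
    (ht₀ : t₀ ∈ I) (h0 : f t₀ = 0) : ∀ t ∈ I, f t = 0 := by
  have right : ∀ {J : Set ℝ} {c f : ℝ → ℝ} {a b : ℝ}, a ≤ b → Set.Icc a b ⊆ J →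
      ContinuousOn c J → (∀ t ∈ J, HasDerivWithinAt f (c t * f t) J t) → f a = 0 → f b = 0 := by
    intro J c f a b hab hJ hc hf h0
    obtain ⟨K, hK⟩ := isCompact_Icc.exists_bound_of_continuousOn (hc.mono hJ)
    -- Grönwall on a compact interval, where the continuous coefficient is bounded by K.
    refine eq_zero_of_abs_deriv_le_mul_abs_self_of_eq_zero_right (f' := fun t => c t * f t)
      (K := K) (fun t ht => ((hf t (hJ ht)).continuousWithinAt).mono hJ) (fun t ht => ?_) h0
      (fun t ht => ?_) b (Set.right_mem_Icc.2 hab)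
    · refine (hf t (hJ (Set.Ico_subset_Icc_self ht))).mono_of_mem_nhdsWithin ?_
      exact Filter.mem_of_superset (Icc_mem_nhdsGE_of_mem ht) hJ
    · rw [norm_mul]
      exact mul_le_mul_of_nonneg_right (hK t (Set.Ico_subset_Icc_self ht)) (norm_nonneg _)
  intro t ht
  rcases le_total t₀ t with h | h
  · exact right h (hI.out ht₀ ht) hc hf h0
  -- Times before t₀ are reached by the reflection t ↦ -t, which changes the sign of the
  -- coefficient.
  · have hneg : ∀ s ∈ -I, HasDerivWithinAt (fun s => f (-s)) (-c (-s) * f (-s)) (-I) s := by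
      intro s hs
      have := (hf (-s) hs).comp s ((hasDerivWithinAt_id s (-I)).neg) (fun r hr => hr)
      exact this.congr_deriv (by ring)
    have := right (J := -I) (c := fun s => -c (-s)) (f := fun s => f (-s)) (neg_le_neg h)
      (fun s hs => hI.out ht ht₀ ⟨le_neg_of_le_neg hs.2, neg_le.1 hs.1⟩)
      ((hc.comp continuous_neg.continuousOn fun s hs => hs).neg) hneg (by simpa using h0)
    simpa using this

/-! ### Evolution of |A|² and of the Weyl entropy -/

namespace SplitSpacetime

variable {M : Type*} [TopologicalSpace M] [ChartedSpace E3 M] {X : SplitSpacetime M}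
  {mass press k : ℝ → M → ℝ} {φ : OpenPartialHomeomorph M E3} {p : ℝ × E3}

theorem hasDerivWithinAt_inCoord (hk : ∀ x, DifferentiableOn ℝ (fun t => k t x) X.I)
    (hp : p ∈ X.dom φ) : HasDerivWithinAt (fun s => inCoord φ k (s, p.2))
      (X.N φ p * X.DT φ (inCoord φ k) p) X.I p.1 := by
  have h := (hk (φ.symm p.2) p.1 hp.1).hasDerivWithinAt
  rw [DT, mul_inv_cancel_left₀ (N_pos hp).ne']
  exact h

variable [IsManifold (𝓡 3) ∞ M]

theorem normW_sq (hF : X.IsPerfectFluid mass press) (hE : X.IsPurelyElectric)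
    (hφ : φ ∈ IsManifold.maximalAtlas (𝓡 3) ∞ M) (hp : p ∈ X.dom φ) (hW : X.W φ p ≠ 0) :
    X.normW φ p ^ 2 = 8 * (X.Emix φ p * X.Emix φ p).trace := by
  have := trace_Emix_sq_pos hF hE hφ hp hW
  rw [normW, normSq_γ_W hF hE hφ hp, Real.sq_sqrt (by positivity)]

theorem normRbar_sq (hF : X.IsPerfectFluid mass press) (hE : X.IsPurelyElectric)
    (hφ : φ ∈ IsManifold.maximalAtlas (𝓡 3) ∞ M) (hp : p ∈ X.dom φ) (hW : X.W φ p ≠ 0) :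
    X.normRbar φ p ^ 2 = X.normW φ p ^ 2 + X.normSqA φ p := by
  have h1 := trace_Emix_sq_pos hF hE hφ hp hW
  have h2 := normSqA_nonneg hF hφ hp
  rw [normW_sq hF hE hφ hp hW, normRbar, normSq_γbar_R hF hE hφ hp, Real.sq_sqrt (by positivity)]

/-- The entropy as an explicit function of `|W|²`, `|A|²` and `√g`. -/
theorem entropy_eq (hF : X.IsPerfectFluid mass press) (hE : X.IsPurelyElectric)
    (hφ : φ ∈ IsManifold.maximalAtlas (𝓡 3) ∞ M) (hp : p ∈ X.dom φ)
    (hpos : 0 < (X.Emix φ p * X.Emix φ p).trace) :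
    X.entropy φ p = √(8 * (X.Emix φ p * X.Emix φ p).trace)
      / √(8 * (X.Emix φ p * X.Emix φ p).trace + X.normSqA φ p) * X.sqrtDet φ p := by
  have hR := normSq_γbar_R hF hE hφ hp
  have h0 : X.R φ p ≠ 0 := by
    intro h
    rw [h, normSq_zero] at hR
    linarith [normSqA_nonneg hF hφ hp]
  rw [entropy, if_neg h0, normWbar, normSq_γbar_W hF hE hφ hp, normRbar, hR]

/-- Eliminates the pressure, leaving M and k, whose time derivatives are available. -/
theorem normSqA_eq_of_state (hF : X.IsPerfectFluid mass press)
    (hstate : ∀ t ∈ X.I, ∀ x, press t x = (k t x - 1) * mass t x)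
    (hφ : φ ∈ IsManifold.maximalAtlas (𝓡 3) ∞ M) (hp : p ∈ X.dom φ) :
    X.normSqA φ p = inCoord φ mass p ^ 2
      * (3 * inCoord φ k p ^ 2 - 4 * inCoord φ k p + 8 / 3) := by
  have hs : inCoord φ press p = (inCoord φ k p - 1) * inCoord φ mass p := hstate _ hp.1 _
  rw [normSqA_eq hF hφ hp, hs]
  ring

theorem hasDerivWithinAt_mass_of_state (hF : X.IsPerfectFluid mass press)
    (hE : X.IsPurelyElectric) (hstate : ∀ t ∈ X.I, ∀ x, press t x = (k t x - 1) * mass t x)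
    (hφ : φ ∈ IsManifold.maximalAtlas (𝓡 3) ∞ M) (hp : p ∈ X.dom φ) :
    HasDerivWithinAt (fun s => inCoord φ mass (s, p.2))
      (X.N φ p * inCoord φ k p * X.H φ p * inCoord φ mass p) X.I p.1 := by
  have hs : inCoord φ press p = (inCoord φ k p - 1) * inCoord φ mass p := hstate _ hp.1 _
  refine (hasDerivWithinAt_mass hF hE hφ hp).congr_deriv ?_
  rw [hs]
  ring

theorem hasDerivWithinAt_normSqA (hF : X.IsPerfectFluid mass press) (hE : X.IsPurelyElectric)
    (hstate : ∀ t ∈ X.I, ∀ x, press t x = (k t x - 1) * mass t x)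
    (hk : ∀ x, DifferentiableOn ℝ (fun t => k t x) X.I)
    (hφ : φ ∈ IsManifold.maximalAtlas (𝓡 3) ∞ M) (hp : p ∈ X.dom φ) :
    HasDerivWithinAt (fun s => X.normSqA φ (s, p.2))
      (X.N φ p * (2 * inCoord φ k p * X.H φ p * X.normSqA φ p
        + 2 * (3 * inCoord φ k p - 2) * inCoord φ mass p ^ 2 * X.DT φ (inCoord φ k) p))
      X.I p.1 := by
  have hm := hasDerivWithinAt_mass_of_state hF hE hstate hφ hp
  have hk' := hasDerivWithinAt_inCoord hk hp
  have h := (hm.pow 2).mul ((((hk'.pow 2).const_mul 3).sub (hk'.const_mul 4)).add_const (8 / 3))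
  refine (h.congr (fun s hs => normSqA_eq_of_state hF hstate hφ (p := (s, p.2)) ⟨hs, hp.2⟩)
    (normSqA_eq_of_state hF hstate hφ hp)).congr_deriv ?_
  rw [normSqA_eq_of_state hF hstate hφ hp]
  simp only [Pi.pow_apply, Pi.sub_apply, Prod.mk.eta]
  norm_num
  ring

/-- The evolution of the Weyl entropy where the Weyl tensor does not vanish. -/
theorem hasDerivWithinAt_entropy (hF : X.IsPerfectFluid mass press) (hE : X.IsPurelyElectric)
    (hstate : ∀ t ∈ X.I, ∀ x, press t x = (k t x - 1) * mass t x)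
    (hk : ∀ x, DifferentiableOn ℝ (fun t => k t x) X.I)
    (hφ : φ ∈ IsManifold.maximalAtlas (𝓡 3) ∞ M) (hp : p ∈ X.dom φ) (hW : X.W φ p ≠ 0) :
    HasDerivWithinAt (fun s => X.entropy φ (s, p.2))
      (X.N φ p * (X.normW φ p / X.normRbar φ p ^ 3 *
          (-(inCoord φ k p * X.H φ p * X.normSqA φ p)
            - X.H φ p * X.normW φ p ^ 2
            - 24 * X.normSqA φ p * (X.hringEE φ p / X.normW φ p ^ 2)
            + 4 * inCoord φ k p * inCoord φ mass p * X.normSqA φ p *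
                (X.hringE φ p / X.normW φ p ^ 2)
            - X.DT φ (inCoord φ k) p * (3 * inCoord φ k p - 2) * inCoord φ mass p ^ 2)
          * X.sqrtDet φ p)) X.I p.1 := by
  have hpos := trace_Emix_sq_pos hF hE hφ hp hW
  have hA0 := normSqA_nonneg hF hφ hp
  have hs : inCoord φ press p = (inCoord φ k p - 1) * inCoord φ mass p := hstate _ hp.1 _
  have hw := hasDerivWithinAt_trace_Emix_sq hF hE hφ hp
  have hA := hasDerivWithinAt_normSqA hF hE hstate hk hφ hp
  have hd := hasDerivWithinAt_sqrtDet (X := X) hφ hp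
  have hw2 := normW_sq hF hE hφ hp hW
  have hr2 := normRbar_sq hF hE hφ hp hW
  have hw8 := hw.const_mul 8
  have h := ((hw8.sqrt (by simp only [Prod.mk.eta]; positivity)).div
    ((hw8.add hA).sqrt (by simp only [Pi.add_apply, Prod.mk.eta]; positivity))
    (by
      simp only [Pi.add_apply, Prod.mk.eta]
      exact (Real.sqrt_pos.2 (by positivity)).ne')).mul hd
  -- The explicit formula needs tr(E²) > 0. This is an open condition along the time line, so the
  -- formula holds near `p.1`, which suffices for the derivative.
  have hev : (fun s => X.entropy φ (s, p.2)) =ᶠ[nhdsWithin p.1 X.I]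
      fun s => √(8 * (X.Emix φ (s, p.2) * X.Emix φ (s, p.2)).trace)
      / √(8 * (X.Emix φ (s, p.2) * X.Emix φ (s, p.2)).trace + X.normSqA φ (s, p.2))
        * X.sqrtDet φ (s, p.2) := by
    have h1 := hw.continuousWithinAt.eventually (lt_mem_nhds (a := 0) hpos)
    filter_upwards [h1, self_mem_nhdsWithin] with s h1 hs
    exact entropy_eq hF hE hφ ⟨hs, hp.2⟩ h1
  refine (h.congr_of_eventuallyEq hev (entropy_eq hF hE hφ hp hpos)).congr_deriv ?_
  simp only [Pi.add_apply, Pi.div_apply, Prod.mk.eta]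
  have e1 : √(8 * (X.Emix φ p * X.Emix φ p).trace) = X.normW φ p := by
    rw [normW, normSq_γ_W hF hE hφ hp]
  have e2 : √(8 * (X.Emix φ p * X.Emix φ p).trace + X.normSqA φ p) = X.normRbar φ p := by
    rw [normRbar, normSq_γbar_R hF hE hφ hp]
  have hwpos : X.normW φ p ≠ 0 := by
    rw [← e1]
    exact (Real.sqrt_pos.2 (by positivity)).ne'
  have hrpos : X.normRbar φ p ≠ 0 := by
    rw [← e2]
    exact (Real.sqrt_pos.2 (by positivity)).ne'
  have htr : (X.Emix φ p * X.Emix φ p).trace = X.normW φ p ^ 2 / 8 := by linarith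
  -- With |A|² = |R|² - |W|² (the norm of R taken in `γbar`) both sides become rational in the two
  -- norms |W| and |R|, and no square root is left.
  have hA2 : X.normSqA φ p = X.normRbar φ p ^ 2 - X.normW φ p ^ 2 := by linarith
  rw [e1, e2, htr, hs, hA2]
  field_simp
  ring

/-- Energy conservation is ∂ₜM = (NkH)M, so uniqueness for this linear equation carries a zero of M
along the whole time line. -/
theorem mass_eq_zero_on_line (hF : X.IsPerfectFluid mass press) (hE : X.IsPurelyElectric)
    (hstate : ∀ t ∈ X.I, ∀ x, press t x = (k t x - 1) * mass t x)
    (hk : ∀ x, DifferentiableOn ℝ (fun t => k t x) X.I)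
    (hφ : φ ∈ IsManifold.maximalAtlas (𝓡 3) ∞ M) (hp : p ∈ X.dom φ)
    (hm : inCoord φ mass p = 0) : ∀ t ∈ X.I, inCoord φ mass (t, p.2) = 0 := by
  refine eq_zero_of_linear_ode X.ordConnected
    (c := fun t => X.N φ (t, p.2) * inCoord φ k (t, p.2) * X.H φ (t, p.2)) ?_ (fun t ht =>
      hasDerivWithinAt_mass_of_state (p := (t, p.2)) hF hE hstate hφ ⟨ht, hp.2⟩) hp.1 hm
  have line : ∀ {f : ℝ × E3 → ℝ}, ContDiffOn ℝ ∞ f (X.dom φ) →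
      ContinuousOn (fun t => f (t, p.2)) X.I := fun hf t ht =>
    (hasDerivWithinAt_time (p := (t, p.2)) hf ⟨ht, hp.2⟩).continuousWithinAt
  have hgi := (smoothMat_g (X := X) hφ).inv fun q hq => (posDef_g hφ hq).det_pos.ne'
  -- NH = -½ g^{ij}∂ₜg_{ij}; the factor N cancels the inverse lapse in h.
  have hNH : ContinuousOn (fun t => X.N φ (t, p.2) * X.H φ (t, p.2)) X.I := by
    have hsm := line (f := fun q => ∑ i, ∑ j, (X.g φ q)⁻¹ i j *
      pd (X.dom φ) 0 (fun q => X.g φ q i j) q) (ContDiffOn.sum fun i _ => ContDiffOn.sum fun j _ =>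
        (hgi i j).mul (contDiffOn_pd (X.uniqueDiffOn_dom φ) (smoothMat_g hφ i j) 0))
    refine (hsm.const_mul (-1 / 2)).congr fun t ht => ?_
    have hp' : (t, p.2) ∈ X.dom φ := ⟨ht, hp.2⟩
    simp only [pd_g hφ hp', H, Finset.mul_sum]
    exact Finset.sum_congr rfl fun i _ => Finset.sum_congr rfl fun j _ => by ring
  have hkc : ContinuousOn (fun t => inCoord φ k (t, p.2)) X.I := (hk (φ.symm p.2)).continuousOn
  exact (hNH.mul hkc).congr fun t _ => by simp only [Pi.mul_apply]; ring

theorem entropy_eq_sqrtDet (hF : X.IsPerfectFluid mass press) (hE : X.IsPurelyElectric)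
    (hφ : φ ∈ IsManifold.maximalAtlas (𝓡 3) ∞ M) (hp : p ∈ X.dom φ) (hA : X.A φ p = 0) :
    X.entropy φ p = X.sqrtDet φ p := by
  have hRW : X.R φ p = X.W φ p := by rw [R_eq_add, hA, add_zero]
  rw [entropy]
  -- Without matter R = W, so the quotient of norms is 1, in agreement with the value assigned where
  -- R = 0.
  split_ifs with h
  · rw [one_mul]
  · have hpos := trace_Emix_sq_pos hF hE hφ hp (hRW ▸ h)
    rw [normWbar, normRbar, hRW, div_self, one_mul]
    rw [normSq_γbar_W hF hE hφ hp]
    exact (Real.sqrt_pos.2 (by positivity)).ne'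

/-- The evolution of the Weyl entropy where the matter content vanishes. -/
theorem hasDerivWithinAt_entropy_of_A_eq_zero (hF : X.IsPerfectFluid mass press)
    (hE : X.IsPurelyElectric) (hstate : ∀ t ∈ X.I, ∀ x, press t x = (k t x - 1) * mass t x)
    (hk : ∀ x, DifferentiableOn ℝ (fun t => k t x) X.I)
    (hφ : φ ∈ IsManifold.maximalAtlas (𝓡 3) ∞ M) (hp : p ∈ X.dom φ) (hA : X.A φ p = 0) :
    HasDerivWithinAt (fun s => X.entropy φ (s, p.2))
      (X.N φ p * (-X.H φ p * X.sqrtDet φ p)) X.I p.1 := by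
  have hm := mass_eq_zero_on_line hF hE hstate hk hφ hp (mass_eq_zero hF hφ hp hA)
  have he : ∀ s ∈ X.I, X.entropy φ (s, p.2) = X.sqrtDet φ (s, p.2) := by
    intro s hs
    have hp' : (s, p.2) ∈ X.dom φ := ⟨hs, hp.2⟩
    refine entropy_eq_sqrtDet hF hE hφ hp' (A_eq_zero hF hφ hp' (hm s hs) ?_)
    have : inCoord φ press (s, p.2) = (inCoord φ k (s, p.2) - 1) * inCoord φ mass (s, p.2) :=
      hstate s hs _
    rw [this, hm s hs, mul_zero]
  exact ((hasDerivWithinAt_sqrtDet hφ hp).congr he (he _ hp.1)).congr_deriv (by ring)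

end SplitSpacetime
end WeylEntropy
end

theorem proposition5p1 {M : Type*} [TopologicalSpace M] [ChartedSpace WeylEntropy.E3 M]
    [IsManifold (𝓡 3) ∞ M] (X : WeylEntropy.SplitSpacetime M) (mass press k : ℝ → M → ℝ)
    (hfluid : X.IsPerfectFluid mass press)
    (hstate : ∀ t ∈ X.I, ∀ x, press t x = (k t x - 1) * mass t x)
    (hk : ∀ x, DifferentiableOn ℝ (fun t => k t x) X.I)
    (helectric : X.IsPurelyElectric)
    (φ : OpenPartialHomeomorph M WeylEntropy.E3)
    (hφ : φ ∈ IsManifold.maximalAtlas (𝓡 3) ∞ M)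
    (p : ℝ × WeylEntropy.E3) (hp : p ∈ X.dom φ) :
    -- the formula where `W ≠ 0`, multiplied out, with `D_T k` for `k' H`
    (X.W φ p ≠ 0 →
      DifferentiableWithinAt ℝ (fun s => X.entropy φ (s, p.2)) X.I p.1 ∧
      X.DT φ (X.entropy φ) p
        = X.normW φ p / X.normRbar φ p ^ 3 *
          (-(WeylEntropy.inCoord φ k p * X.H φ p * X.normSqA φ p)
            - X.H φ p * X.normW φ p ^ 2
            - 24 * X.normSqA φ p * (X.hringEE φ p / X.normW φ p ^ 2)
            + 4 * WeylEntropy.inCoord φ k p * WeylEntropy.inCoord φ mass p * X.normSqA φ p *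
                (X.hringE φ p / X.normW φ p ^ 2)
            - X.DT φ (WeylEntropy.inCoord φ k) p * (3 * WeylEntropy.inCoord φ k p - 2) * WeylEntropy.inCoord φ mass p ^ 2)
          * X.sqrtDet φ p) ∧
    -- the formula with `k'`, where `W ≠ 0`, `A ≠ 0` and `D_T k = k' H`
    (X.W φ p ≠ 0 → X.A φ p ≠ 0 → (X.H φ p = 0 → X.DT φ (WeylEntropy.inCoord φ k) p = 0) →
      X.DT φ (X.entropy φ) p
        = X.normW φ p * X.normSqA φ p / X.normRbar φ p ^ 3 *
          (-(WeylEntropy.inCoord φ k p * X.H φ p)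
            - X.H φ p * (X.normW φ p ^ 2 / X.normSqA φ p)
            - 24 * (X.hringEE φ p / X.normW φ p ^ 2)
            + 4 * WeylEntropy.inCoord φ k p * WeylEntropy.inCoord φ mass p * (X.hringE φ p / X.normW φ p ^ 2)
            - X.H φ p * (X.kPrime φ k p * (3 * WeylEntropy.inCoord φ k p - 2) * WeylEntropy.inCoord φ mass p ^ 2
                / X.normSqA φ p))
          * X.sqrtDet φ p) ∧
    -- where `A = 0` the formula is read as `D_T 𝒮 = -H √g`
    (X.A φ p = 0 →
      DifferentiableWithinAt ℝ (fun s => X.entropy φ (s, p.2)) X.I p.1 ∧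
      X.DT φ (X.entropy φ) p = -(X.H φ p) * X.sqrtDet φ p) := by
  have hN := (WeylEntropy.SplitSpacetime.N_pos hp).ne'
  have key := fun hW : X.W φ p ≠ 0 =>
    WeylEntropy.SplitSpacetime.hasDerivWithinAt_entropy hfluid helectric hstate hk hφ hp hW
  have hDT := fun hW : X.W φ p ≠ 0 =>
    (WeylEntropy.SplitSpacetime.DT_of_hasDerivWithinAt hp (key hW)).trans
      (inv_mul_cancel_left₀ hN _)
  refine ⟨fun hW => ⟨(key hW).differentiableWithinAt, hDT hW⟩, fun hW hA hH => ?_, fun hA => ?_⟩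
  · have hA0 := (WeylEntropy.SplitSpacetime.normSqA_pos hfluid hφ hp hA).ne'
    -- At H = 0 the convention k' = 0 is consistent only because D_T k = 0 is assumed there. After
    -- this replacement, |A|² ≠ 0 is factored out of the bracket.
    have hk' : X.DT φ (WeylEntropy.inCoord φ k) p = X.H φ p * X.kPrime φ k p := by
      rw [WeylEntropy.SplitSpacetime.kPrime]
      split_ifs with h
      · rw [hH h, h, zero_mul]
      · rw [mul_div_cancel₀ _ h]
    rw [hDT hW, hk']
    field_simp
  · have h := WeylEntropy.SplitSpacetime.hasDerivWithinAt_entropy_of_A_eq_zero hfluid helectric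
      hstate hk hφ hp hA
    exact ⟨h.differentiableWithinAt,
      (WeylEntropy.SplitSpacetime.DT_of_hasDerivWithinAt hp h).trans (inv_mul_cancel_left₀ hN _)⟩
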